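/- Let $n\ge 1$, $\gamma\in(0,1)$, $T>0$, $\tau>0$, $p>0$, $s\ge p+2$ and $\theta>1$. Let $\widehat f(\xi)=(2\pi)^{-n/2}\int_{\mathbb R^n}f(x)e^{-ix\cdot\xi}\,dx$ denote the Fourier transform, extended to $L^2(\mathbb R^n)$, and let $\|f\|_{H^r}=\|(1+|\xi|^2)^{r/2}\widehat f(\xi)\|_{L^2}$. Let $E_{\gamma,1}(z)=\sum_{k\ge 0} z^k/\Gamma(\gamma k+1)$, let $\varphi$ be the kernel with $\widehat\varphi(\xi)=(2\pi)^{-n/2}e^{-\tau|\xi|^s}$, and put $\varphi_\alpha(x)=\alpha^{-n}\varphi(x/\alpha)$ and $M_\alpha f=\varphi_\alpha\star f$ for $\alpha>0$. Let $u\in C([0,T],L^2(\mathbb R^n))\cap C((0,T],H^2(\mathbb R^n))$ be a solution of $\partial^\gamma u/\partial t^\gamma=\Delta u$ on $\mathbb R^n\times(0,T)$, where $\frac{\partial^\gamma u}{\partial t^\gamma}(\cdot,t)=\frac1{\Gamma(1-\gamma)}\int_0^t\frac{u'(\cdot,r)}{(t-r)^\gamma}\,dr$ is the Caputo derivative and the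 equation holds in $L^2(\mathbb R^n)$ for every $t\in(0,T)$. Here $u$ is differentiable on $(0,T)$ as an $L^2$-valued function, and the integral is a Bochner integral in $L^2(\mathbb R^n)$. Let $E>0$ and $\delta$ be real numbers, and suppose that $$\|u(\cdot,0)\|_{H^p}\le E .$$ Let $g^\delta\in L^2(\mathbb R^n)$ satisfy $\|u(\cdot,T)-g^\delta\|_{L^2}\le\delta$ and $0<\theta\delta<\|g^\delta\|_{L^2}$. For $\alpha>0$ define the regularized solution $u^\delta_\alpha$ by $$\widehat{u^\delta_\alpha}(\xi,t)=(2\pi)^{n/2}\,\frac{E_{\gamma,1}(-|\xi|^2t^\gamma)}{E_{\gamma,1}(-|\xi|^2T^\gamma)}\,\widehat\varphi(\alpha\xi)\,\widehat{g^\delta}(\xi),\qquad t\in[0,T],$$ and choose the parameter by the Morozov a-posteriori rule $$\alpha_*=\alpha(\delta,g^\delta)=\sup\{\alpha>0:\ \|g^\delta-M_\alpha g^\delta\|_{L^2}<\theta\delta\}.$$ Then $\alpha_*$ is well defined (the set is non-empty and bounded above, $\alpha_*>0$, and $\alpha_*$ is the unique $\alpha>0$ with $\|g^\delta-M_\alpha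 g^\delta\|_{L^2}=\theta\delta$), the formula above defines $u^\delta_{\alpha_*}(\cdot,t)\in L^2(\mathbb R^n)$ for all $t\in[0,T]$, and there is a constant $C>0$ depending only on $n,\gamma,T,\tau,s,p,\theta$ (in particular independent of $\delta$, $E$, $t$, $l$, $u$ and $g^\delta$) such that for all $t\in(0,T]$ and all $l\in[0,p+2]$ with $p+2-l\le s$, $$\|u(\cdot,t)-u^\delta_{\alpha_*}(\cdot,t)\|_{H^l}\le\frac{C}{t^\gamma}\,E^{\frac{l}{p+2}}\,\delta^{1-\frac{l}{p+2}} .$$ In particular, for all $t\in(0,T]$, $\|u(\cdot,t)-u^\delta_{\alpha_*}(\cdot,t)\|_{L^2}\le C\,\delta/t^\gamma$. -/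

import Mathlib

noncomputable section

namespace FractionalDiffusion

open MeasureTheory Set Filter Topology
open scoped FourierTransform ENNReal Laplacian SchwartzMap

/-- The space `ℝⁿ` with its Euclidean norm. -/
abbrev Space (n : ℕ) : Type := EuclideanSpace ℝ (Fin n)

/-- The Hilbert space `L²(ℝⁿ)` of complex-valued functions. -/
abbrev L2 (n : ℕ) : Type := Lp ℂ 2 (volume : Measure (Space n))

/-- The Fourier transform on `L²(ℝⁿ)` in the unitary angular-frequency normalisation
`f̂(ξ) = (2π)^{-n/2} ∫ f(x) e^{-i x·ξ} dx`. Mathlib's transform `𝓕` has the phase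
`e^{-2πi x·ξ}`, whence the rescaling. -/
def fourierL2 {n : ℕ} (f : L2 n) : Space n → ℂ := fun ξ =>
  (((√(2 * Real.pi) ^ n)⁻¹ : ℝ) : ℂ) * (𝓕 f : L2 n) ((2 * Real.pi)⁻¹ • ξ)

open Classical in
/-- The element of `L²(ℝⁿ)` whose Fourier transform (in the normalisation of `fourierL2`) is `h`,
for square integrable `h`; it is `0` if `h` is not square integrable. -/
def ofFourierL2 {n : ℕ} (h : Space n → ℂ) : L2 n :=
  if hh : MemLp (fun η : Space n => ((√(2 * Real.pi) ^ n : ℝ) : ℂ) * h ((2 * Real.pi) • η)) 2 volume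
  then 𝓕⁻ hh.toLp
  else 0

/-- The Sobolev norm `‖f‖_{H^r} = ‖(1 + |ξ|²)^{r/2} f̂(ξ)‖_{L²}`, with the value `∞` exactly if
`f ∉ H^r(ℝⁿ)`. -/
def sobolevNorm {n : ℕ} (r : ℝ) (f : L2 n) : ℝ≥0∞ :=
  eLpNorm (fun ξ : Space n => (((1 + ‖ξ‖ ^ 2) ^ (r / 2) : ℝ) : ℂ) * fourierL2 f ξ) 2 volume

/-- The Caputo derivative
`(∂^γ u / ∂t^γ)(t) = (1 / Γ(1 - γ)) ∫_0^t u'(s) / (t - s)^γ ds` of an `L²(ℝⁿ)`-valued function,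
as a Bochner integral in `L²(ℝⁿ)`. -/
def caputoDeriv {n : ℕ} (γ : ℝ) (u : ℝ → L2 n) (t : ℝ) : L2 n :=
  (Real.Gamma (1 - γ))⁻¹ • ∫ s in (0 : ℝ)..t, ((t - s) ^ γ)⁻¹ • deriv u s

/-- `u` is a solution of `∂^γ u / ∂t^γ = Δ u` on `ℝⁿ × (0, T)`: it belongs to
`C([0,T], L²) ∩ C((0,T], H²)`, its Caputo derivative exists on `(0,T)`, and the equation holds
in `L²(ℝⁿ)` for every `t ∈ (0,T)`, with `Δ` the distributional Laplacian. -/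
structure IsSolution {n : ℕ} (γ T : ℝ) (u : ℝ → L2 n) : Prop where
  continuousOn : ContinuousOn u (Icc 0 T)
  memH2 : ∀ t ∈ Ioc 0 T, sobolevNorm 2 (u t) < ∞
  continuousH2 : ∀ t₀ ∈ Ioc 0 T,
    Tendsto (fun t => sobolevNorm 2 (u t - u t₀)) (𝓝[Ioc 0 T] t₀) (𝓝 0)
  differentiable : ∀ t ∈ Ioo 0 T, DifferentiableAt ℝ u t
  integrable : ∀ t ∈ Ioo 0 T,
    IntervalIntegrable (fun s => ((t - s) ^ γ)⁻¹ • deriv u s) volume 0 t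
  equation : ∀ t ∈ Ioo 0 T,
    Lp.toTemperedDistribution (caputoDeriv γ u t) = Δ (Lp.toTemperedDistribution (u t))

/-- The Mittag-Leffler function `E_{γ,1}(x) = ∑_k x^k / Γ(γ k + 1)` at real arguments. -/
def mittagLeffler (γ x : ℝ) : ℝ := ∑' k : ℕ, x ^ k / Real.Gamma (γ * k + 1)

/-- The Fourier transform `φ̂(ξ) = (2π)^{-n/2} exp(-τ |ξ|^s)` of the mollifier kernel. -/
def kernelHat {n : ℕ} (τ s : ℝ) (ξ : Space n) : ℝ :=
  (√(2 * Real.pi) ^ n)⁻¹ * Real.exp (-τ * ‖ξ‖ ^ s)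

/-- The mollifier kernel `φ(x) = (2π)^{-n/2} ∫ φ̂(ξ) e^{i x·ξ} dξ`. -/
def kernel {n : ℕ} (τ s : ℝ) (x : Space n) : ℂ :=
  (((√(2 * Real.pi) ^ n)⁻¹ : ℝ) : ℂ) *
    ∫ ξ : Space n, (kernelHat τ s ξ : ℂ) * Complex.exp (Complex.I * (inner ℝ x ξ : ℝ))

/-- The mollifier `M_α f = φ_α ⋆ f` with `φ_α(x) = α^{-n} φ(x / α)`. -/
def mollify {n : ℕ} (τ s α : ℝ) (f : L2 n) (x : Space n) : ℂ :=
  ∫ y : Space n, (((α ^ n)⁻¹ : ℝ) : ℂ) * kernel τ s (α⁻¹ • (x - y)) * f y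

/-- The discrepancy `‖g^δ - M_α g^δ‖_{L²}`. -/
def discrepancy {n : ℕ} (τ s α : ℝ) (gδ : L2 n) : ℝ≥0∞ :=
  eLpNorm (fun x => gδ x - mollify τ s α gδ x) 2 volume

/-- The set of all `α > 0` with `‖g^δ - M_α g^δ‖_{L²} < θ δ`. -/
def morozovSet {n : ℕ} (τ s θ δ : ℝ) (gδ : L2 n) : Set ℝ :=
  {α | 0 < α ∧ discrepancy τ s α gδ < ENNReal.ofReal (θ * δ)}

/-- The a-posteriori parameter
`α(δ, g^δ) = sup {α > 0 : ‖g^δ - M_α g^δ‖_{L²} < θ δ}`. -/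
def morozovParameter {n : ℕ} (τ s θ δ : ℝ) (gδ : L2 n) : ℝ :=
  sSup (morozovSet τ s θ δ gδ)

/-- The Fourier transform of the regularised solution at time `t`,
`(2π)^{n/2} (E_{γ,1}(-|ξ|² t^γ) / E_{γ,1}(-|ξ|² T^γ)) φ̂(α ξ) ĝ^δ(ξ)`. -/
def regularizedHat {n : ℕ} (γ T τ s α : ℝ) (gδ : L2 n) (t : ℝ) (ξ : Space n) : ℂ :=
  ((√(2 * Real.pi) ^ n *
      (mittagLeffler γ (-‖ξ‖ ^ 2 * t ^ γ) / mittagLeffler γ (-‖ξ‖ ^ 2 * T ^ γ)) *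
      kernelHat τ s (α • ξ) : ℝ) : ℂ) * fourierL2 gδ ξ

/-- The regularised solution `u_α^δ(·, t)`. -/
def regularizedSolution {n : ℕ} (γ T τ s α : ℝ) (gδ : L2 n) (t : ℝ) : L2 n :=
  ofFourierL2 (regularizedHat γ T τ s α gδ t)

end FractionalDiffusion

end

/-! On the Fourier side the equation decouples into scalar relaxation equations, so û(t) =
E_{γ,1}(-|ξ|²t^γ) û(0), and the error at time t factorises as û(t) - û_α(t) = ρ_t D. Here ρ_t =
E_{γ,1}(-|ξ|²t^γ)/E_{γ,1}(-|ξ|²T^γ) and D = û(T) - S_α ĝ, with S_α the symbol of the mollifier.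
Since E_{γ,1}(-x) is bounded above and below by multiples of 1/(1+x), ρ_t ≤ C/t^γ uniformly in ξ
(`timeRatio_le`); only D remains to be estimated.

Write q = p+2 and W_q for the Sobolev weight of order q. The forward evolution gains two
derivatives, so ‖W_q û(T)‖ ≤ C E. In L², D is the data error plus (1-S_α)ĝ, hence at most (1+θ)δ by
the choice of α. For the weighted norm, W_q D = (1-S_α)W_q û(T) + W_q S_α(û(T)-ĝ) and W_q S_α ≤
K(1+α^{-q}). The discrepancy equation keeps α from being too small: θδ ≤ δ + ‖(1-S_α)û(T)‖ ≤ δ +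
(1+τ)α^q‖W_q û(T)‖, and θ > 1 turns this into α^{-q}δ ≤ C E (`exists_final_error_bound`).
Interpolating between the two bounds gives E^{l/q}δ^{1-l/q} (`exists_sobolevNorm_error_bound`).

Two ingredients are established from scratch. The Mittag-Leffler bounds (`mittagLeffler_neg_bounds`)
rest on positivity of the resolvent kernel t^{γ-1}E_{γ,γ}(-t^γ), whose convolution identities are
read off from the series. The solution formula (`IsSolution.fourier_ae_eq`) follows by truncating
frequencies to a ball, where the Laplacian is bounded: the Caputo equation becomes a Volterra
equation whose Picard iterates are the partial sums of E_{γ,1}.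

The discrepancy is continuous and strictly increasing in α, from 0 to ‖g‖, which makes the Morozov
parameter well defined. -/

noncomputable section

namespace FractionalDiffusion

open MeasureTheory Set Filter Topology
open scoped FourierTransform ENNReal Laplacian SchwartzMap

/-! ### Riemann–Liouville kernels and Mittag-Leffler series -/

/-- The Riemann–Liouville kernel `t ^ (b - 1) / Γ(b)`. -/
def rlKernel (b t : ℝ) : ℝ := t ^ (b - 1) / Real.Gamma b

/-- The two-parameter Mittag-Leffler function `E_{γ,b}(x) = ∑ x ^ k / Γ(γ k + b)`. -/
def mittagLeffler₂ (γ b x : ℝ) : ℝ := ∑' k : ℕ, x ^ k / Real.Gamma (γ * k + b)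

/-- The relaxation kernel `t ^ (b - 1) E_{γ,b}(-t ^ γ)`. -/
def relaxKernel (γ b t : ℝ) : ℝ := t ^ (b - 1) * mittagLeffler₂ γ b (-t ^ γ)

theorem rlKernel_nonneg {b t : ℝ} (hb : 0 < b) (ht : 0 ≤ t) : 0 ≤ rlKernel b t :=
  div_nonneg (Real.rpow_nonneg ht _) (Real.Gamma_pos_of_pos hb).le

theorem rlKernel_pos {b t : ℝ} (hb : 0 < b) (ht : 0 < t) : 0 < rlKernel b t :=
  div_pos (Real.rpow_pos_of_pos ht _) (Real.Gamma_pos_of_pos hb)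

theorem intervalIntegrable_rlKernel {b : ℝ} (hb : 0 < b) (s t : ℝ) :
    IntervalIntegrable (rlKernel b) volume s t :=
  (intervalIntegral.intervalIntegrable_rpow' (by linarith)).div_const _

theorem intervalIntegrable_rlKernel_sub {b : ℝ} (hb : 0 < b) (s t x : ℝ) :
    IntervalIntegrable (fun r => rlKernel b (x - r)) volume s t := by
  have := (intervalIntegrable_rlKernel hb (x - s) (x - t)).comp_sub_left x
  simpa using this

theorem integral_rlKernel {b t : ℝ} (hb : 0 < b) :
    ∫ r in (0 : ℝ)..t, rlKernel b r = rlKernel (b + 1) t := by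
  simp only [rlKernel]
  rw [intervalIntegral.integral_div, integral_rpow (Or.inl (by linarith)),
    Real.Gamma_add_one hb.ne']
  have := (Real.Gamma_pos_of_pos hb).ne'
  rw [sub_add_cancel, add_sub_cancel_right, Real.zero_rpow hb.ne']
  field_simp
  simp

theorem integral_rlKernel_sub {b x s : ℝ} (hb : 0 < b) :
    ∫ r in s..x, rlKernel b (x - r) = rlKernel (b + 1) (x - s) := by
  rw [intervalIntegral.integral_comp_sub_left (fun r => rlKernel b r) x]
  simp [integral_rlKernel hb]

theorem intervalIntegrable_rlKernel_mul {a b t : ℝ} (ha : 0 < a) (hb : 0 < b) (ht : 0 < t) :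
    IntervalIntegrable (fun r => rlKernel a (t - r) * rlKernel b r) volume 0 t := by
  -- The two factors are singular at opposite ends, so on each half of the interval one of them is
  -- continuous.
  have h1 : IntervalIntegrable (fun r => rlKernel a (t - r) * rlKernel b r) volume 0 (t / 2) := by
    refine (intervalIntegrable_rlKernel hb 0 (t / 2)).continuousOn_mul ?_
    unfold rlKernel
    refine ContinuousOn.div_const (ContinuousOn.rpow_const (by fun_prop) ?_) _
    intro x hx
    rw [uIcc_of_le (by linarith)] at hx
    left; linarith [hx.2]
  have h2 : IntervalIntegrable (fun r => rlKernel a (t - r) * rlKernel b r) volume (t / 2) t := by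
    refine (intervalIntegrable_rlKernel_sub ha (t / 2) t t).mul_continuousOn ?_
    unfold rlKernel
    refine ContinuousOn.div_const (ContinuousOn.rpow_const (by fun_prop) ?_) _
    intro x hx
    rw [uIcc_of_le (by linarith)] at hx
    left; linarith [hx.1]
  exact h1.trans h2

/-- The semigroup property of the Riemann–Liouville kernels under convolution. -/
theorem integral_rlKernel_mul {a b t : ℝ} (ha : 0 < a) (hb : 0 < b) (ht : 0 < t) :
    ∫ r in (0 : ℝ)..t, rlKernel a (t - r) * rlKernel b r = rlKernel (a + b) t := by
  have key := Complex.betaIntegral_scaled b a ht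
  rw [Complex.betaIntegral_eq_Gamma_mul_div _ _ (by simpa) (by simpa)] at key
  have h1 : ∫ x in (0 : ℝ)..t, (x : ℂ) ^ ((b : ℂ) - 1) * ((t : ℂ) - x) ^ ((a : ℂ) - 1)
      = ((∫ x in (0 : ℝ)..t, x ^ (b - 1) * (t - x) ^ (a - 1) : ℝ) : ℂ) := by
    rw [← intervalIntegral.integral_ofReal]
    refine intervalIntegral.integral_congr fun x hx => ?_
    rw [uIcc_of_le ht.le] at hx
    rw [Complex.ofReal_mul, Complex.ofReal_cpow hx.1, Complex.ofReal_cpow (by linarith [hx.2])]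
    push_cast
    rfl
  have h2 : (t : ℂ) ^ ((b : ℂ) + a - 1) = ((t ^ (b + a - 1) : ℝ) : ℂ) := by
    rw [Complex.ofReal_cpow ht.le]; push_cast; rfl
  rw [h1, h2, ← Complex.ofReal_add, Complex.Gamma_ofReal, Complex.Gamma_ofReal,
    Complex.Gamma_ofReal] at key
  have key' : ∫ x in (0 : ℝ)..t, x ^ (b - 1) * (t - x) ^ (a - 1) =
      t ^ (b + a - 1) * (Real.Gamma b * Real.Gamma a / Real.Gamma (b + a)) := by
    exact_mod_cast key
  have ga := (Real.Gamma_pos_of_pos ha).ne'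
  have gb := (Real.Gamma_pos_of_pos hb).ne'
  have : ∀ r, rlKernel a (t - r) * rlKernel b r =
      (r ^ (b - 1) * (t - r) ^ (a - 1)) * (Real.Gamma a * Real.Gamma b)⁻¹ := by
    intro r; unfold rlKernel; field_simp
  simp_rw [this]
  rw [intervalIntegral.integral_mul_const, key', rlKernel, add_comm b a]
  field_simp

/-- Euler's integral is cut down to (M, ∞), where t^(x-1) ≥ M^(x-1). As M is free, Γ outgrows every
geometric sequence, which is what convergence of the Mittag-Leffler series needs. -/
theorem rpow_mul_exp_neg_le_Gamma {x M : ℝ} (hx : 1 ≤ x) (hM : 0 < M) :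
    M ^ (x - 1) * Real.exp (-M) ≤ Real.Gamma x := by
  rw [Real.Gamma_eq_integral (by linarith)]
  have hint := Real.GammaIntegral_convergent (s := x) (by linarith)
  calc M ^ (x - 1) * Real.exp (-M)
      = ∫ t in Ioi M, Real.exp (-t) * M ^ (x - 1) := by
        rw [integral_mul_const, integral_exp_neg_Ioi, mul_comm]
    _ ≤ ∫ t in Ioi M, Real.exp (-t) * t ^ (x - 1) := by
        refine setIntegral_mono_on ?_ (hint.mono_set (Ioi_subset_Ioi hM.le)) measurableSet_Ioi ?_
        · exact (exp_neg_integrableOn_Ioi M one_pos |>.congr_fun (by intro t _; simp)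
            measurableSet_Ioi).mul_const _
        · intro t ht
          have : M ≤ t := le_of_lt ht
          gcongr
    _ ≤ ∫ t in Ioi 0, Real.exp (-t) * t ^ (x - 1) := by
        refine setIntegral_mono_set hint ?_ (Ioi_subset_Ioi hM.le).eventuallyLE
        filter_upwards [ae_restrict_mem measurableSet_Ioi] with t ht
        exact mul_nonneg (Real.exp_pos _).le (Real.rpow_nonneg (le_of_lt ht) _)

theorem summable_pow_div_Gamma {γ b : ℝ} (hγ : 0 < γ) (hb : 0 < b) (x : ℝ) :
    Summable fun k : ℕ => x ^ k / Real.Gamma (γ * k + b) := by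
  -- Chosen so that M^γ = 2|x| + 1; the terms are then dominated by a geometric series of ratio
  -- |x|/(2|x|+1) < 1.
  set M : ℝ := (2 * |x| + 1) ^ γ⁻¹
  have hM0 : 0 < M := by positivity
  have hMγ : M ^ γ = 2 * |x| + 1 := by
    rw [← Real.rpow_mul (by positivity), inv_mul_cancel₀ hγ.ne', Real.rpow_one]
  have hgeo : Summable fun k : ℕ => (M ^ (b - 1) * Real.exp (-M))⁻¹ * (|x| / (2 * |x| + 1)) ^ k := by
    refine (summable_geometric_of_lt_one (by positivity) ?_).mul_left _
    rw [div_lt_one (by positivity)]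
    linarith [abs_nonneg x]
  obtain ⟨N, hN⟩ := exists_nat_gt (1 / γ)
  have hN' : 1 ≤ γ * N := by
    rw [div_lt_iff₀ hγ] at hN; linarith
  refine Summable.of_norm_bounded_eventually_nat hgeo ?_
  filter_upwards [eventually_ge_atTop N] with k hk
  have h1 : 1 ≤ γ * k + b := by
    have : (N : ℝ) ≤ k := by exact_mod_cast hk
    nlinarith
  have h2 := rpow_mul_exp_neg_le_Gamma h1 hM0
  have h3 : M ^ (γ * k + b - 1) = (2 * |x| + 1) ^ k * M ^ (b - 1) := by
    rw [add_sub_assoc, Real.rpow_add hM0, Real.rpow_mul hM0.le, hMγ, Real.rpow_natCast]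
  rw [h3] at h2
  rw [norm_div, norm_pow, Real.norm_eq_abs, Real.norm_eq_abs,
    abs_of_pos (Real.Gamma_pos_of_pos (by linarith)), div_pow]
  calc |x| ^ k / Real.Gamma (γ * k + b)
      ≤ |x| ^ k / ((2 * |x| + 1) ^ k * M ^ (b - 1) * Real.exp (-M)) := by gcongr
    _ = _ := by field_simp

theorem continuous_mittagLeffler₂ {γ b : ℝ} (hγ : 0 < γ) (hb : 0 < b) :
    Continuous (mittagLeffler₂ γ b) := by
  rw [continuous_iff_continuousAt]
  intro x
  have : ContinuousOn (mittagLeffler₂ γ b) (Icc (-(|x| + 1)) (|x| + 1)) := by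
    refine continuousOn_tsum (fun k => by fun_prop) (summable_pow_div_Gamma hγ hb (|x| + 1)) ?_
    intro k y hy
    have hG : 0 < Real.Gamma (γ * k + b) := Real.Gamma_pos_of_pos (by positivity)
    rw [norm_div, norm_pow, Real.norm_eq_abs, Real.norm_eq_abs, abs_of_pos hG]
    gcongr
    exact abs_le.2 hy
  refine this.continuousAt (Icc_mem_nhds ?_ ?_)
  · linarith [neg_abs_le x]
  · linarith [le_abs_self x]

theorem mittagLeffler₂_one (γ x : ℝ) : mittagLeffler₂ γ 1 x = mittagLeffler γ x := rfl

theorem continuous_mittagLeffler {γ : ℝ} (hγ : 0 < γ) : Continuous (mittagLeffler γ) :=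
  continuous_mittagLeffler₂ hγ one_pos

theorem mittagLeffler₂_zero (γ b : ℝ) : mittagLeffler₂ γ b 0 = (Real.Gamma b)⁻¹ := by
  rw [mittagLeffler₂, tsum_eq_single 0]
  · simp
  · intro k hk; simp [hk]

theorem hasSum_relaxKernel {γ b t : ℝ} (hγ : 0 < γ) (hb : 0 < b) (ht : 0 < t) :
    HasSum (fun k : ℕ => (-1) ^ k * rlKernel (γ * k + b) t) (relaxKernel γ b t) := by
  have h := ((summable_pow_div_Gamma hγ hb (-t ^ γ)).hasSum).mul_left (t ^ (b - 1))
  refine (congrArg (HasSum · (relaxKernel γ b t)) (funext fun k => ?_)).mpr h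
  rw [rlKernel, add_sub_assoc, Real.rpow_add ht, Real.rpow_mul ht.le, Real.rpow_natCast,
    neg_pow (t ^ γ)]
  ring

theorem relaxKernel_one {γ t : ℝ} : relaxKernel γ 1 t = mittagLeffler γ (-t ^ γ) := by
  simp [relaxKernel, mittagLeffler₂_one]

/-- Raising the index by γ shifts the alternating series by one place: the k = 0 term drops out and
the signs flip. -/
theorem relaxKernel_add {γ b t : ℝ} (hγ : 0 < γ) (hb : 0 < b) (ht : 0 < t) :
    relaxKernel γ (γ + b) t = rlKernel b t - relaxKernel γ b t := by
  have h1 := hasSum_relaxKernel hγ (add_pos hγ hb) ht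
  have h2 := (hasSum_nat_add_iff' 1).2 (hasSum_relaxKernel hγ hb ht)
  have h3 := h2.neg
  have h4 := h1.unique (by
    convert! h3 using 2 with k
    push_cast
    rw [show γ * k + (γ + b) = γ * (k + 1) + b by ring]
    ring)
  rw [h4]
  simp

theorem continuousOn_relaxKernel {γ b : ℝ} (hγ : 0 < γ) (hb : 0 < b) :
    ContinuousOn (relaxKernel γ b) (Ioi 0) := by
  refine ContinuousOn.mul (continuousOn_id.rpow_const fun x hx => Or.inl (ne_of_gt hx)) ?_
  refine (continuous_mittagLeffler₂ hγ hb).comp_continuousOn ?_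
  exact (continuousOn_id.rpow_const fun x hx => Or.inl (ne_of_gt hx)).neg

theorem intervalIntegrable_rlKernel_mul_relaxKernel {γ a b t : ℝ} (hγ : 0 < γ) (ha : 0 < a)
    (hb : 0 < b) (ht : 0 < t) :
    IntervalIntegrable (fun r => rlKernel a (t - r) * relaxKernel γ b r) volume 0 t := by
  have h := (intervalIntegrable_rlKernel_mul ha hb ht).mul_continuousOn
    (g := fun r => Real.Gamma b * mittagLeffler₂ γ b (-r ^ γ)) (by
      refine continuousOn_const.mul ((continuous_mittagLeffler₂ hγ hb).comp_continuousOn ?_)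
      exact (Real.continuous_rpow_const hγ.le).continuousOn.neg)
  refine h.congr ?_
  intro r _
  have := (Real.Gamma_pos_of_pos hb).ne'
  simp only [rlKernel, relaxKernel]
  field_simp

/-- Convolution with a Riemann–Liouville kernel raises the index of a relaxation kernel. -/
theorem integral_rlKernel_mul_relaxKernel {γ a b t : ℝ} (hγ : 0 < γ) (ha : 0 < a)
    (hb : 0 < b) (ht : 0 < t) :
    ∫ r in (0 : ℝ)..t, rlKernel a (t - r) * relaxKernel γ b r = relaxKernel γ (a + b) t := by
  have hb' : ∀ k : ℕ, 0 < γ * k + b := fun k => by positivity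
  set F : ℕ → ℝ → ℝ := fun k r => (-1) ^ k * (rlKernel a (t - r) * rlKernel (γ * k + b) r)
  have hI : ∀ k, ∫ r in Ioc 0 t, F k r = (-1) ^ k * rlKernel (γ * k + (a + b)) t := by
    intro k
    rw [integral_const_mul, ← intervalIntegral.integral_of_le ht.le,
      integral_rlKernel_mul ha (hb' k) ht]
    congr 2; ring
  have hN : ∀ k, ∫ r in Ioc 0 t, ‖F k r‖ = rlKernel (γ * k + (a + b)) t := by
    intro k
    rw [show γ * k + (a + b) = a + (γ * k + b) by ring, ← integral_rlKernel_mul ha (hb' k) ht,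
      intervalIntegral.integral_of_le ht.le]
    refine setIntegral_congr_fun measurableSet_Ioc fun r hr => ?_
    have h1 := rlKernel_nonneg ha (sub_nonneg.2 hr.2)
    have h2 := rlKernel_nonneg (hb' k) hr.1.le
    simp [F, abs_of_nonneg h1, abs_of_nonneg h2]
  have hint : ∀ k, Integrable (F k) (volume.restrict (Ioc 0 t)) := fun k =>
    (((intervalIntegrable_iff_integrableOn_Ioc_of_le ht.le).1
      (intervalIntegrable_rlKernel_mul ha (hb' k) ht))).const_mul _
  -- Each Riemann–Liouville kernel is nonnegative, so these integrals are the absolute values of the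
  -- terms of `relaxKernel γ (a + b) t`, which justifies termwise integration.
  have hsum : Summable fun k => ∫ r in Ioc 0 t, ‖F k r‖ := by
    simp_rw [hN]
    have := (hasSum_relaxKernel hγ (add_pos ha hb) ht).summable.norm
    refine this.congr fun k => ?_
    rw [norm_mul, norm_pow, norm_neg, norm_one, one_pow, one_mul, Real.norm_eq_abs,
      abs_of_pos (rlKernel_pos (by positivity) ht)]
  have h := hasSum_integral_of_summable_integral_norm hint hsum
  simp_rw [hI] at h
  rw [(hasSum_relaxKernel hγ (add_pos ha hb) ht).unique h, intervalIntegral.integral_of_le ht.le]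
  refine setIntegral_congr_fun measurableSet_Ioc fun r hr => ?_
  rw [← (hasSum_relaxKernel hγ hb hr.1).tsum_eq, ← tsum_mul_left]
  refine tsum_congr fun k => ?_
  simp only [F]; ring

/-! ### Positivity and two-sided bounds on the negative half-line -/

/-- Positivity of the resolvent kernel, by a first-zero argument which uses the log-convexity of
the Riemann–Liouville kernel of index at most one. -/
theorem mittagLeffler₂_neg_pos {γ t : ℝ} (hγ : 0 < γ) (hγ₁ : γ < 1) (ht : 0 ≤ t) :
    0 < mittagLeffler₂ γ γ (-t ^ γ) := by
  set G : ℝ → ℝ := fun t => mittagLeffler₂ γ γ (-t ^ γ)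
  have hG : Continuous G :=
    (continuous_mittagLeffler₂ hγ hγ).comp (Real.continuous_rpow_const hγ.le).neg
  by_contra! hneg
  set S : Set ℝ := Ici 0 ∩ {t | G t ≤ 0}
  have hS : IsClosed S := isClosed_Ici.inter (isClosed_le hG continuous_const)
  have hbdd : BddBelow S := ⟨0, fun x hx => hx.1⟩
  set t₀ := sInf S
  have ht₀ : t₀ ∈ S := hS.csInf_mem ⟨t, ht, hneg⟩ hbdd
  have hG0 : 0 < G 0 := by
    simp only [G, Real.zero_rpow hγ.ne', neg_zero, mittagLeffler₂_zero]
    exact inv_pos.2 (Real.Gamma_pos_of_pos hγ)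
  have h0 : 0 < t₀ := by
    rcases eq_or_lt_of_le (show 0 ≤ t₀ from ht₀.1) with h | h
    · have := ht₀.2
      rw [← h] at this
      exact absurd hG0 (not_lt.2 this)
    · exact h
  set v : ℝ → ℝ := relaxKernel γ γ
  have hvpos : ∀ r, 0 < r → r < t₀ → 0 < v r := by
    intro r hr hr'
    refine mul_pos (Real.rpow_pos_of_pos hr _) ?_
    by_contra! h
    exact absurd (csInf_le hbdd ⟨hr.le, h⟩) (not_le.2 hr')
  have hv0 : v t₀ ≤ 0 := mul_nonpos_of_nonneg_of_nonpos (Real.rpow_nonneg h0.le _) ht₀.2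
  -- As a → t₀ the left side tends to 0 and the right side to 1. Fixing such an a makes the kernel
  -- mass near t₀ too small to pull v down to zero.
  have hlim : ∀ᶠ a in 𝓝[<] t₀, rlKernel (γ + 1) (t₀ - a) < (a / t₀) ^ (1 - γ) := by
    have c1 : ContinuousAt (fun a => rlKernel (γ + 1) (t₀ - a)) t₀ := by
      unfold rlKernel
      refine ContinuousAt.div_const (ContinuousAt.rpow_const (by fun_prop) (Or.inr ?_)) _
      linarith
    have c2 : ContinuousAt (fun a => (a / t₀) ^ (1 - γ)) t₀ :=
      ContinuousAt.rpow_const (by fun_prop) (Or.inr (by linarith))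
    refine (c1.eventually_lt c2 ?_).filter_mono nhdsWithin_le_nhds
    simp [rlKernel, hγ.ne', h0.ne']
  obtain ⟨a, ⟨ha1, ha2⟩, ha⟩ := ((hlim.and (Ioo_mem_nhdsLT h0)).exists).imp
    fun a h => And.intro h.2 h.1
  -- The comparison point is a maximiser of v on [a, t₀]; it is not t₀, since v(t₁) ≥ v(a) > 0 ≥
  -- v(t₀).
  obtain ⟨t₁, ht₁, hmax⟩ := isCompact_Icc.exists_isMaxOn (nonempty_Icc.2 ha2.le)
    ((continuousOn_relaxKernel hγ hγ).mono (fun x (hx : x ∈ Icc a t₀) => ha1.trans_le hx.1))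
  have hva : 0 < v t₁ := (hvpos a ha1 ha2).trans_le (hmax (left_mem_Icc.2 ha2.le))
  have ht₁' : t₁ < t₀ := lt_of_le_of_ne ht₁.2 (by rintro h; rw [h] at hva; linarith)
  have ht₁0 : 0 < t₁ := ha1.trans_le ht₁.1
  have eq : ∀ x, 0 < x → v x = rlKernel γ x - ∫ r in (0 : ℝ)..x, rlKernel γ (x - r) * v r := by
    intro x hx
    rw [integral_rlKernel_mul_relaxKernel hγ hγ hγ hx, relaxKernel_add hγ hγ hx]
    ring
  have hi0 := intervalIntegrable_rlKernel_mul_relaxKernel hγ hγ hγ h0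
  have hi1 := intervalIntegrable_rlKernel_mul_relaxKernel hγ hγ hγ ht₁0
  have hi01 := hi0.mono_set (c := 0) (d := t₁) (by
    rw [uIcc_of_le ht₁0.le, uIcc_of_le h0.le]; exact Icc_subset_Icc_right ht₁'.le)
  have hi10 := hi0.mono_set (c := t₁) (d := t₀) (by
    rw [uIcc_of_le ht₁'.le, uIcc_of_le h0.le]; exact Icc_subset_Icc_left ht₁0.le)
  set ρ := (t₁ / t₀) ^ (1 - γ)
  have hρ : rlKernel γ t₀ = ρ * rlKernel γ t₁ := by
    simp only [rlKernel, ρ]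
    rw [Real.div_rpow ht₁0.le h0.le, show γ - 1 = -(1 - γ) by ring, Real.rpow_neg h0.le,
      Real.rpow_neg ht₁0.le]
    have : t₁ ^ (1 - γ) ≠ 0 := (Real.rpow_pos_of_pos ht₁0 _).ne'
    field_simp
  -- Pointwise (t₁-r)/(t₀-r) ≤ t₁/t₀; raised to the power 1-γ this gives k(t₀-r) ≤ ρ k(t₁-r) for the
  -- kernel k of index γ. The same ρ relates k(t₀) to k(t₁) with equality.
  have b1 : ∫ r in (0 : ℝ)..t₁, rlKernel γ (t₀ - r) * v r ≤
      ρ * ∫ r in (0 : ℝ)..t₁, rlKernel γ (t₁ - r) * v r := by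
    rw [← intervalIntegral.integral_const_mul]
    refine intervalIntegral.integral_mono_on_of_le_Ioo ht₁0.le hi01 (hi1.const_mul ρ) ?_
    intro r hr
    have hvr := hvpos r hr.1 (hr.2.trans ht₁')
    have hx : 0 < t₁ - r := sub_pos.2 hr.2
    have hy : 0 < t₀ - r := hx.trans (by linarith)
    rw [← mul_assoc]
    refine mul_le_mul_of_nonneg_right ?_ hvr.le
    simp only [rlKernel, ρ]
    rw [← mul_div_assoc]
    refine div_le_div_of_nonneg_right ?_ (Real.Gamma_pos_of_pos hγ).le
    rw [show γ - 1 = -(1 - γ) by ring, Real.rpow_neg hx.le, Real.rpow_neg hy.le,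
      ← Real.inv_rpow hx.le, ← Real.inv_rpow hy.le, ← Real.mul_rpow (by positivity) (by positivity)]
    refine Real.rpow_le_rpow (by positivity) ?_ (by linarith)
    rw [← div_eq_mul_inv, div_div, inv_eq_one_div, div_le_div_iff₀ hy (by positivity)]
    nlinarith [hr.1]
  have b2 : ∫ r in t₁..t₀, rlKernel γ (t₀ - r) * v r ≤ rlKernel (γ + 1) (t₀ - t₁) * v t₁ := by
    rw [← integral_rlKernel_sub hγ, ← intervalIntegral.integral_mul_const]
    refine intervalIntegral.integral_mono_on_of_le_Ioo ht₁'.le hi10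
      ((intervalIntegrable_rlKernel_sub hγ _ _ _).mul_const _) ?_
    intro r hr
    exact mul_le_mul_of_nonneg_left (hmax ⟨ht₁.1.trans hr.1.le, hr.2.le⟩)
      (rlKernel_nonneg hγ (by linarith [hr.2]))
  have e0 := eq t₀ h0
  have e1 := eq t₁ ht₁0
  rw [← intervalIntegral.integral_add_adjacent_intervals hi01 hi10] at e0
  have e2 : ∫ r in (0 : ℝ)..t₁, rlKernel γ (t₁ - r) * v r = rlKernel γ t₁ - v t₁ := by linarith
  rw [e2] at b1
  have m1 : rlKernel (γ + 1) (t₀ - t₁) ≤ rlKernel (γ + 1) (t₀ - a) := by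
    simp only [rlKernel]
    refine div_le_div_of_nonneg_right ?_ (Real.Gamma_pos_of_pos (by linarith)).le
    exact Real.rpow_le_rpow (by linarith) (by linarith [ht₁.1]) (by linarith)
  have m2 : (a / t₀) ^ (1 - γ) ≤ ρ := by
    refine Real.rpow_le_rpow (by positivity) ?_ (by linarith)
    exact div_le_div_of_nonneg_right ht₁.1 h0.le
  -- Subtracting ρ times the resolvent equation at t₁ from the one at t₀ leaves v(t₀) ≥ (ρ -
  -- `rlKernel (γ + 1) (t₀ - t₁)`) v(t₁) > 0, a contradiction.
  have : rlKernel (γ + 1) (t₀ - t₁) * v t₁ < ρ * v t₁ :=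
    mul_lt_mul_of_pos_right (by linarith) hva
  nlinarith

theorem relaxKernel_pos {γ t : ℝ} (hγ : 0 < γ) (hγ₁ : γ < 1) (ht : 0 < t) :
    0 < relaxKernel γ γ t :=
  mul_pos (Real.rpow_pos_of_pos ht _) (mittagLeffler₂_neg_pos hγ hγ₁ ht.le)

theorem rlKernel_one (t : ℝ) : rlKernel 1 t = 1 := by simp [rlKernel]

/-- The kernel of index 1 is constant, so convolving with it is integration. Thus `relaxKernel γ γ`
is the density of 1 - E_{γ,1}(-t^γ), and its positivity makes E_{γ,1}(-t^γ) decreasing. -/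
theorem integral_relaxKernel {γ t : ℝ} (hγ : 0 < γ) (ht : 0 < t) :
    IntervalIntegrable (relaxKernel γ γ) volume 0 t ∧
      ∫ r in (0 : ℝ)..t, relaxKernel γ γ r = 1 - relaxKernel γ 1 t := by
  have h1 := intervalIntegrable_rlKernel_mul_relaxKernel hγ one_pos hγ ht
  have h2 := integral_rlKernel_mul_relaxKernel hγ one_pos hγ ht
  simp only [rlKernel_one, one_mul] at h1 h2
  rw [add_comm, relaxKernel_add hγ one_pos ht, rlKernel_one] at h2
  exact ⟨h1, h2⟩

theorem relaxKernel_one_anti {γ r t : ℝ} (hγ : 0 < γ) (hγ₁ : γ < 1) (hr : 0 < r) (hrt : r ≤ t) :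
    relaxKernel γ 1 t ≤ relaxKernel γ 1 r := by
  have ht := hr.trans_le hrt
  obtain ⟨i1, h1⟩ := integral_relaxKernel hγ hr
  obtain ⟨i2, h2⟩ := integral_relaxKernel hγ ht
  have h3 := intervalIntegral.integral_interval_sub_left i2 i1
  have h4 : 0 ≤ ∫ x in r..t, relaxKernel γ γ x :=
    intervalIntegral.integral_nonneg hrt fun x hx => (relaxKernel_pos hγ hγ₁ (hr.trans_le hx.1)).le
  linarith

/-- Two-sided bounds for the Mittag-Leffler function on the negative half-line. -/
theorem mittagLeffler_neg_bounds {γ x : ℝ} (hγ : 0 < γ) (hγ₁ : γ < 1) (hx : 0 ≤ x) :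
    (1 + Real.Gamma (1 - γ) * x)⁻¹ ≤ mittagLeffler γ (-x) ∧
      mittagLeffler γ (-x) ≤ (1 + x / Real.Gamma (γ + 1))⁻¹ := by
  have hΓ₁ : 0 < Real.Gamma (1 - γ) := Real.Gamma_pos_of_pos (by linarith)
  have hΓ₂ : 0 < Real.Gamma (γ + 1) := Real.Gamma_pos_of_pos (by linarith)
  rcases hx.eq_or_lt with rfl | hx
  · rw [neg_zero, ← mittagLeffler₂_one, mittagLeffler₂_zero]; simp
  set t := x ^ γ⁻¹
  have ht : 0 < t := Real.rpow_pos_of_pos hx _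
  have htx : t ^ γ = x := by rw [← Real.rpow_mul hx.le, inv_mul_cancel₀ hγ.ne', Real.rpow_one]
  have hy : mittagLeffler γ (-x) = relaxKernel γ 1 t := by rw [relaxKernel_one, htx]
  rw [hy]
  obtain ⟨i1, h1⟩ := integral_relaxKernel hγ ht
  constructor
  · have hγ' : 0 < 1 - γ := by linarith
    have h2 := integral_rlKernel_mul_relaxKernel hγ hγ' hγ ht
    rw [sub_add_cancel] at h2
    -- Write y = `relaxKernel γ 1`. It is the convolution of the decreasing kernel of index 1-γ with
    -- the positive density of 1 - y; replacing that kernel by its value at t gives y(t) ≥ k(t)(1 -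
    -- y(t)).
    have h3 : ∫ r in (0 : ℝ)..t, rlKernel (1 - γ) t * relaxKernel γ γ r ≤ relaxKernel γ 1 t := by
      rw [← h2]
      refine intervalIntegral.integral_mono_on_of_le_Ioo ht.le (i1.const_mul _)
        (intervalIntegrable_rlKernel_mul_relaxKernel hγ hγ' hγ ht) fun r hr => ?_
      refine mul_le_mul_of_nonneg_right ?_ (relaxKernel_pos hγ hγ₁ hr.1).le
      refine div_le_div_of_nonneg_right ?_ hΓ₁.le
      exact Real.rpow_le_rpow_of_nonpos (by linarith [hr.2]) (by linarith [hr.1]) (by linarith)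
    rw [intervalIntegral.integral_const_mul, h1] at h3
    have h4 : rlKernel (1 - γ) t = (Real.Gamma (1 - γ) * x)⁻¹ := by
      rw [rlKernel, show 1 - γ - 1 = -γ by ring, Real.rpow_neg ht.le, htx]
      field_simp
    rw [h4, inv_mul_le_iff₀ (by positivity)] at h3
    rw [inv_le_iff_one_le_mul₀ (by positivity)]
    linarith
  · have h2 := integral_rlKernel_mul_relaxKernel hγ hγ one_pos ht
    rw [relaxKernel_add hγ one_pos ht, rlKernel_one] at h2
    -- Here 1 - y is the fractional integral of order γ of y, and y is decreasing, so y may be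
    -- replaced by y(t) from below.
    have h3 : ∫ r in (0 : ℝ)..t, rlKernel γ (t - r) * relaxKernel γ 1 t ≤
        1 - relaxKernel γ 1 t := by
      rw [← h2]
      refine intervalIntegral.integral_mono_on_of_le_Ioo ht.le
        ((intervalIntegrable_rlKernel_sub hγ _ _ _).mul_const _)
        (intervalIntegrable_rlKernel_mul_relaxKernel hγ hγ one_pos ht) fun r hr => ?_
      exact mul_le_mul_of_nonneg_left (relaxKernel_one_anti hγ hγ₁ hr.1 hr.2.le)
        (rlKernel_nonneg hγ (by linarith [hr.2]))
    rw [intervalIntegral.integral_mul_const, integral_rlKernel_sub hγ, sub_zero] at h3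
    have h4 : rlKernel (γ + 1) t = x / Real.Gamma (γ + 1) := by
      rw [rlKernel, add_sub_cancel_right, htx]
    rw [h4] at h3
    rw [← one_div, le_div_iff₀ (by positivity)]
    linarith

/-! ### Fractional integrals and the Volterra equation -/

theorem measurable_rlKernel (b : ℝ) : Measurable (rlKernel b) :=
  (measurable_id.pow_const _).div_const _

theorem rlKernel_beta_shift {a b r t : ℝ} (ha : 0 < a) (hb : 0 < b) (hrt : r < t) :
    IntegrableOn (fun s => rlKernel a (t - s) * rlKernel b (s - r)) (Ioo r t) ∧
      ∫ s in Ioo r t, rlKernel a (t - s) * rlKernel b (s - r) = rlKernel (a + b) (t - r) := by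
  have h1 := (intervalIntegrable_rlKernel_mul ha hb (sub_pos.2 hrt)).comp_sub_right r
  have h2 := integral_rlKernel_mul ha hb (sub_pos.2 hrt)
  have e : ∀ s, t - r - (s - r) = t - s := fun s => by ring
  simp only [e, zero_add, sub_add_cancel] at h1
  have h3 := intervalIntegral.integral_comp_sub_right (a := r) (b := t)
    (fun x => rlKernel a (t - r - x) * rlKernel b x) r
  simp only [e, sub_self] at h3
  rw [h2, intervalIntegral.integral_of_le hrt.le, integral_Ioc_eq_integral_Ioo] at h3
  exact ⟨(intervalIntegrable_iff_integrableOn_Ioo_of_le hrt.le).1 h1, h3⟩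

section Volterra

variable {X : Type*} [NormedAddCommGroup X] [NormedSpace ℝ X]

/-- Fractional integration of orders `a` and `b` with `a + b = 1` composes to integration. -/
theorem integral_rlKernel_integral_rlKernel [CompleteSpace X] {a b t : ℝ} (ha : 0 < a) (hb : 0 < b)
    (hab : a + b = 1) (ht : 0 < t) {f : ℝ → X} (hf : StronglyMeasurable f)
    (hfi : IntervalIntegrable f volume 0 t) :
    IntervalIntegrable (fun s => rlKernel a (t - s) • ∫ r in (0 : ℝ)..s, rlKernel b (s - r) • f r)
        volume 0 t ∧
      ∫ s in (0 : ℝ)..t, rlKernel a (t - s) • ∫ r in (0 : ℝ)..s, rlKernel b (s - r) • f r =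
        ∫ r in (0 : ℝ)..t, f r := by
  set μ : Measure ℝ := volume.restrict (Ioo 0 t)
  -- Integrand on the triangle 0 < r < s < t. Integrating in s first leaves the kernel of index a +
  -- b = 1, that is the constant 1; this gives both the Fubini hypothesis and the value.
  set F : ℝ → ℝ → X := fun s r =>
    (Ioi r).indicator (fun s => (rlKernel a (t - s) * rlKernel b (s - r)) • f r) s
  have hFr : ∀ s r, F s r =
      (Iio s).indicator (fun r => (rlKernel a (t - s) * rlKernel b (s - r)) • f r) r := by
    intro s r
    simp only [F, indicator_apply, mem_Ioi, mem_Iio]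
  have hfμ : Integrable f μ := (intervalIntegrable_iff_integrableOn_Ioo_of_le ht.le).1 hfi
  have hFm : AEStronglyMeasurable (Function.uncurry F) (μ.prod μ) := by
    have hk : Measurable fun p : ℝ × ℝ => rlKernel a (t - p.1) * rlKernel b (p.1 - p.2) :=
      ((measurable_rlKernel a).comp (measurable_const.sub measurable_fst)).mul
        ((measurable_rlKernel b).comp (measurable_fst.sub measurable_snd))
    have h := (hk.stronglyMeasurable.smul (hf.comp_measurable measurable_snd)).indicator
      (measurableSet_lt measurable_snd measurable_fst)
    exact h.aestronglyMeasurable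
  have hcap : ∀ r, 0 < r → Ioo 0 t ∩ Ioi r = Ioo r t := by
    intro r hr; ext s; simp only [mem_inter_iff, mem_Ioo, mem_Ioi]
    constructor
    · rintro ⟨⟨_, h⟩, h'⟩; exact ⟨h', h⟩
    · rintro ⟨h, h'⟩; exact ⟨⟨hr.trans h, h'⟩, h⟩
  have hint1 : ∀ r ∈ Ioo 0 t, Integrable (fun s => F s r) μ := by
    intro r hr
    have h := (rlKernel_beta_shift ha hb hr.2).1.smul_const (f r)
    rw [integrable_indicator_iff measurableSet_Ioi, IntegrableOn,
      Measure.restrict_restrict measurableSet_Ioi, inter_comm, hcap r hr.1]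
    exact h
  have hint2 : ∀ r ∈ Ioo 0 t, ∫ s, ‖F s r‖ ∂μ = ‖f r‖ := by
    intro r hr
    have e : ∀ s, ‖F s r‖ = (Ioi r).indicator
        (fun s => ‖(rlKernel a (t - s) * rlKernel b (s - r)) • f r‖) s := fun s =>
      norm_indicator_eq_indicator_norm _ _
    simp_rw [e]
    rw [setIntegral_indicator measurableSet_Ioi, hcap r hr.1]
    have h := (rlKernel_beta_shift ha hb hr.2).2
    rw [hab, rlKernel_one] at h
    rw [← one_mul ‖f r‖, ← h, ← integral_mul_const]
    refine setIntegral_congr_fun measurableSet_Ioo fun s hs => ?_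
    have h1 := rlKernel_nonneg ha (sub_nonneg.2 hs.2.le)
    have h2 := rlKernel_nonneg hb (sub_nonneg.2 hs.1.le)
    simp only [norm_smul, norm_mul, Real.norm_eq_abs, abs_of_nonneg h1, abs_of_nonneg h2]
  have hint3 : ∀ r ∈ Ioo 0 t, ∫ s, F s r ∂μ = f r := by
    intro r hr
    rw [setIntegral_indicator measurableSet_Ioi, hcap r hr.1, integral_smul_const,
      (rlKernel_beta_shift ha hb hr.2).2, hab, rlKernel_one, one_smul]
  have hF : Integrable (Function.uncurry F) (μ.prod μ) := by
    rw [integrable_prod_iff' hFm]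
    constructor
    · filter_upwards [ae_restrict_mem measurableSet_Ioo] with r hr using hint1 r hr
    · refine hfμ.norm.congr ?_
      filter_upwards [ae_restrict_mem measurableSet_Ioo] with r hr using (hint2 r hr).symm
  have hinner : ∀ s ∈ Ioo 0 t, ∫ r, F s r ∂μ =
      rlKernel a (t - s) • ∫ r in (0 : ℝ)..s, rlKernel b (s - r) • f r := by
    intro s hs
    simp_rw [hFr]
    rw [setIntegral_indicator measurableSet_Iio, intervalIntegral.integral_of_le hs.1.le,
      integral_Ioc_eq_integral_Ioo, ← integral_smul]
    simp_rw [smul_smul]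
    congr 2
    ext r; simp only [mem_inter_iff, mem_Ioo, mem_Iio]
    constructor
    · rintro ⟨⟨h, _⟩, h'⟩; exact ⟨h, h'⟩
    · rintro ⟨h, h'⟩; exact ⟨⟨h, h'.trans hs.2⟩, h'⟩
  constructor
  · rw [intervalIntegrable_iff_integrableOn_Ioo_of_le ht.le]
    refine hF.integral_prod_left.congr ?_
    filter_upwards [ae_restrict_mem measurableSet_Ioo] with s hs using hinner s hs
  · rw [intervalIntegral.integral_of_le ht.le, intervalIntegral.integral_of_le ht.le,
      integral_Ioc_eq_integral_Ioo, integral_Ioc_eq_integral_Ioo,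
      ← setIntegral_congr_fun measurableSet_Ioo hinner, integral_integral_swap hF,
      setIntegral_congr_fun measurableSet_Ioo hint3]

/-- Fractional integration of order `γ` inverts the Caputo derivative of order `γ`. -/
theorem integral_rlKernel_caputo [CompleteSpace X] {γ t : ℝ} (hγ₀ : 0 < γ) (hγ₁ : γ < 1)
    (ht : 0 < t) {u : ℝ → X} (hc : ContinuousOn u (Icc 0 t))
    (hd : ∀ r ∈ Ioo 0 t, DifferentiableAt ℝ u r)
    (hi : IntervalIntegrable (fun s => ((t - s) ^ γ)⁻¹ • deriv u s) volume 0 t) :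
    IntervalIntegrable (fun s => rlKernel γ (t - s) •
        ((Real.Gamma (1 - γ))⁻¹ • ∫ r in (0 : ℝ)..s, ((s - r) ^ γ)⁻¹ • deriv u r)) volume 0 t ∧
      ∫ s in (0 : ℝ)..t, rlKernel γ (t - s) •
        ((Real.Gamma (1 - γ))⁻¹ • ∫ r in (0 : ℝ)..s, ((s - r) ^ γ)⁻¹ • deriv u r) =
        u t - u 0 := by
  -- The singular weight is removed by multiplying with the continuous function (t-s)^γ, which
  -- cancels it on the open interval.
  have hint : IntervalIntegrable (deriv u) volume 0 t := by
    have h := hi.continuousOn_smul (f := fun s => (t - s) ^ γ)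
      ((Real.continuous_rpow_const hγ₀.le).comp (continuous_const.sub continuous_id)).continuousOn
    rw [intervalIntegrable_iff_integrableOn_Ioo_of_le ht.le] at h ⊢
    refine h.congr_fun (fun s hs => ?_) measurableSet_Ioo
    have : (t - s) ^ γ ≠ 0 := (Real.rpow_pos_of_pos (sub_pos.2 hs.2) _).ne'
    simp only [smul_smul, mul_inv_cancel₀ this, one_smul]
  have h := integral_rlKernel_integral_rlKernel hγ₀ (sub_pos.2 hγ₁) (by ring) ht
    (stronglyMeasurable_deriv u) hint
  have e : EqOn (fun s => rlKernel γ (t - s) •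
      ∫ r in (0 : ℝ)..s, rlKernel (1 - γ) (s - r) • deriv u r) (fun s => rlKernel γ (t - s) •
        ((Real.Gamma (1 - γ))⁻¹ • ∫ r in (0 : ℝ)..s, ((s - r) ^ γ)⁻¹ • deriv u r)) (uIcc 0 t) := by
    intro s hs
    rw [uIcc_of_le ht.le] at hs
    refine congrArg (rlKernel γ (t - s) • ·) ?_
    rw [← intervalIntegral.integral_smul]
    refine intervalIntegral.integral_congr fun r hr => ?_
    rw [uIcc_of_le hs.1] at hr
    simp only [rlKernel, smul_smul]
    rw [show 1 - γ - 1 = -γ by ring, Real.rpow_neg (sub_nonneg.2 hr.2), div_eq_mul_inv, mul_comm]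
  rw [← intervalIntegral.integral_congr e, h.2,
    intervalIntegral.integral_eq_sub_of_hasDerivAt_of_le ht.le hc
      (fun x hx => (hd x hx).hasDerivAt) hint]
  exact ⟨h.1.congr (e.mono uIoc_subset_uIcc), rfl⟩

/-- Picard iteration for the weakly singular Volterra equation `w = w₀ - I^γ A w`. -/
theorem tendsto_picard_of_volterra [CompleteSpace X] {γ T : ℝ} (hγ : 0 < γ) (A : X →L[ℝ] X) {w : ℝ → X} {w₀ : X}
    (hc : ContinuousOn w (Icc 0 T))
    (hw : ∀ t ∈ Ioo 0 T, w t = w₀ - ∫ s in (0 : ℝ)..t, rlKernel γ (t - s) • A (w s))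
    {t : ℝ} (ht : t ∈ Ioo 0 T) :
    Tendsto (fun N : ℕ => ∑ k ∈ Finset.range N, rlKernel (γ * k + 1) t • ((-A) ^ k) w₀) atTop
      (𝓝 (w t)) := by
  set S : ℕ → ℝ → X := fun N t => ∑ k ∈ Finset.range N, rlKernel (γ * k + 1) t • ((-A) ^ k) w₀
  obtain ⟨M, hM⟩ := isCompact_Icc.exists_bound_of_continuousOn hc
  have hk : ∀ k : ℕ, 0 < γ * k + 1 := fun k => by positivity
  have hSint : ∀ N : ℕ, ∀ t, 0 < t →
      IntervalIntegrable (fun s => rlKernel γ (t - s) • A (S N s)) volume 0 t ∧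
      w₀ - ∫ s in (0 : ℝ)..t, rlKernel γ (t - s) • A (S N s) = S (N + 1) t := by
    intro N t ht
    have e : (fun s => rlKernel γ (t - s) • A (S N s)) = fun s => ∑ k ∈ Finset.range N,
        (rlKernel γ (t - s) * rlKernel (γ * k + 1) s) • A (((-A) ^ k) w₀) := by
      funext s
      simp only [S, map_sum, map_smul, Finset.smul_sum, smul_smul]
    have hi : ∀ k ∈ Finset.range N, IntervalIntegrable (fun s =>
        (rlKernel γ (t - s) * rlKernel (γ * k + 1) s) • A (((-A) ^ k) w₀)) volume 0 t := fun k _ =>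
      (intervalIntegrable_rlKernel_mul hγ (hk k) ht).smul_continuousOn continuousOn_const
    rw [e]
    refine ⟨by simpa only [Finset.sum_fn] using IntervalIntegrable.sum _ hi, ?_⟩
    rw [intervalIntegral.integral_finsetSum hi]
    simp only [S]
    rw [Finset.sum_range_succ', sub_eq_add_neg, add_comm, ← Finset.sum_neg_distrib]
    congr 1
    · refine Finset.sum_congr rfl fun k _ => ?_
      rw [intervalIntegral.integral_smul_const, integral_rlKernel_mul hγ (hk k) ht, pow_succ',
        mul_apply_eq_comp, neg_apply, smul_neg]
      congr 3
      push_cast; ring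
    · simp [rlKernel_one]
  have hwint : ∀ t ∈ Ioo 0 T, IntervalIntegrable (fun s => rlKernel γ (t - s) • A (w s))
      volume 0 t := by
    intro t ht
    refine (intervalIntegrable_rlKernel_sub hγ 0 t t).smul_continuousOn ?_
    rw [uIcc_of_le ht.1.le]
    exact A.continuous.comp_continuousOn (hc.mono (Icc_subset_Icc_right ht.2.le))
  -- The error after N steps is bounded by the N-fold fractional integral of the constant M, times
  -- ‖A‖^N.
  have hbound : ∀ N : ℕ, ∀ t ∈ Ioo 0 T,
      ‖w t - S N t‖ ≤ M * ‖A‖ ^ N * rlKernel (γ * N + 1) t := by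
    intro N
    induction N with
    | zero =>
      intro t ht
      simpa [S, rlKernel_one] using hM t ⟨ht.1.le, ht.2.le⟩
    | succ N ih =>
      intro t ht
      obtain ⟨i1, h1⟩ := hSint N t ht.1
      have i2 := hwint t ht
      have h2 : w t - S (N + 1) t =
          -∫ s in (0 : ℝ)..t, rlKernel γ (t - s) • A (w s - S N s) := by
        simp only [map_sub, smul_sub]
        rw [intervalIntegral.integral_sub i2 i1, ← h1, hw t ht]
        abel
      have h3 : M * ‖A‖ ^ (N + 1) * rlKernel (γ * (N + 1 : ℕ) + 1) t = ∫ s in (0 : ℝ)..t,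
          M * ‖A‖ ^ (N + 1) * (rlKernel γ (t - s) * rlKernel (γ * N + 1) s) := by
        rw [intervalIntegral.integral_const_mul, integral_rlKernel_mul hγ (hk N) ht.1]
        congr 2; push_cast; ring
      rw [h2, norm_neg, h3]
      refine intervalIntegral.norm_integral_le_of_norm_le ht.1.le ?_
        ((intervalIntegrable_rlKernel_mul hγ (hk N) ht.1).const_mul _)
      refine Eventually.of_forall fun s hs => ?_
      have hs' : s ∈ Ioo 0 T := ⟨hs.1, hs.2.trans_lt ht.2⟩
      have hkn := rlKernel_nonneg hγ (sub_nonneg.2 hs.2)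
      rw [norm_smul, Real.norm_eq_abs, abs_of_nonneg hkn]
      calc rlKernel γ (t - s) * ‖A (w s - S N s)‖
          ≤ rlKernel γ (t - s) * (‖A‖ * (M * ‖A‖ ^ N * rlKernel (γ * N + 1) s)) := by
            gcongr
            exact (A.le_opNorm _).trans (by gcongr; exact ih s hs')
        _ = _ := by ring
  -- Up to the factor M this is the general term of the convergent series for E_{γ,1}(‖A‖ t^γ).
  have hlim : Tendsto (fun N : ℕ => M * ‖A‖ ^ N * rlKernel (γ * N + 1) t) atTop (𝓝 0) := by
    have h := (summable_pow_div_Gamma hγ one_pos (‖A‖ * t ^ γ)).tendsto_atTop_zero.const_mul M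
    rw [mul_zero] at h
    refine h.congr fun N => ?_
    rw [rlKernel, add_sub_cancel_right, Real.rpow_mul ht.1.le, Real.rpow_natCast, mul_pow]
    ring
  rw [tendsto_iff_norm_sub_tendsto_zero]
  refine squeeze_zero (fun _ => norm_nonneg _) (fun N => ?_) hlim
  rw [norm_sub_rev]
  exact hbound N t ht

end Volterra

/-! ### The solution formula on the Fourier side -/

variable {n : ℕ}

/-- Multiplication by a bounded measurable real function, as a bounded operator on `L²`. -/
theorem exists_multiplication_operator {m : Space n → ℝ} (hm : Measurable m) {C : ℝ}
    (hC : ∀ η, |m η| ≤ C) :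
    ∃ A : L2 n →L[ℝ] L2 n, ∀ f : L2 n, A f =ᵐ[volume] fun η => (m η : ℂ) * f η := by
  have hb : ∀ (f : L2 n) (η : Space n), ‖(m η : ℂ) * f η‖ ≤ C * ‖f η‖ := fun f η => by
    rw [norm_mul, Complex.norm_real, Real.norm_eq_abs]
    exact mul_le_mul_of_nonneg_right (hC η) (norm_nonneg _)
  have hmem : ∀ f : L2 n, MemLp (fun η => (m η : ℂ) * f η) 2 volume := fun f =>
    (Lp.memLp f).of_le_mul
      ((Complex.measurable_ofReal.comp hm).aestronglyMeasurable.mul (Lp.aestronglyMeasurable f))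
      (Eventually.of_forall (hb f))
  let L : L2 n →ₗ[ℝ] L2 n :=
    { toFun := fun f => (hmem f).toLp
      map_add' := fun f g => by
        rw [← MemLp.toLp_add]
        refine MemLp.toLp_congr _ _ ?_
        filter_upwards [Lp.coeFn_add f g] with η h
        simp only [h, Pi.add_apply, mul_add]
      map_smul' := fun c f => by
        rw [RingHom.id_apply, ← MemLp.toLp_const_smul]
        refine MemLp.toLp_congr _ _ ?_
        filter_upwards [Lp.coeFn_smul c f] with η h
        simp only [h, Pi.smul_apply, mul_smul_comm] }
  refine ⟨L.mkContinuous C fun f => ?_, fun f => (hmem f).coeFn_toLp⟩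
  refine Lp.norm_le_mul_norm_of_ae_le_mul ?_
  have hL : L f =ᵐ[volume] fun η => (m η : ℂ) * f η := (hmem f).coeFn_toLp
  filter_upwards [hL] with η h
  rw [h]
  exact hb f η

/-- A distributional Laplace equation in `L²` becomes a multiplication on the Fourier side. -/
theorem fourier_ae_eq_of_eq_laplacian {f g : L2 n}
    (h : Lp.toTemperedDistribution f = Δ (Lp.toTemperedDistribution g)) :
    (𝓕 f : L2 n) =ᵐ[volume]
      fun η => ((-((2 * Real.pi) ^ 2 * ‖η‖ ^ 2) : ℝ) : ℂ) * (𝓕 g : L2 n) η := by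
  have hl : ∀ f : L2 n, LocallyIntegrable f volume := fun f =>
    (Lp.memLp f).locallyIntegrable one_le_two
  refine ae_eq_of_integral_contDiff_smul_eq (hl _) ?_ ?_
  · rw [← locallyIntegrableOn_univ]
    exact (hl _).locallyIntegrableOn univ |>.continuousOn_mul (by fun_prop)
      isOpen_univ.isLocallyClosed
  · intro φ hφ hcφ
    have hcφ' : HasCompactSupport (Complex.ofRealCLM ∘ φ) := hcφ.comp_left rfl
    have hφ' : ContDiff ℝ (↑(⊤ : ℕ∞)) (Complex.ofRealCLM ∘ φ) := by fun_prop
    -- The distributional Laplacian is the Fourier multiplier with symbol -(2π)²‖x‖². Testing the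
    -- transformed identity against compactly supported smooth functions identifies the two locally
    -- integrable functions.
    have h1 : 𝓕 (Lp.toTemperedDistribution f) = 𝓕 (Δ (Lp.toTemperedDistribution g)) := by rw [h]
    rw [TemperedDistribution.laplacian_eq_fourierMultiplierCLM,
      TemperedDistribution.fourierMultiplierCLM_apply, Lp.fourier_toTemperedDistribution_eq,
      ← Complex.coe_smul, FourierTransform.fourier_smul, FourierTransform.fourier_fourierInv_eq,
      Lp.fourier_toTemperedDistribution_eq] at h1
    have h2 := congrArg (fun S : 𝓢'(Space n, ℂ) => S (hcφ'.toSchwartzMap hφ')) h1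
    have hg : (fun x : Space n => Complex.ofReal (‖x‖ ^ 2)).HasTemperateGrowth := by fun_prop
    have h3 : ((-(2 * Real.pi) ^ 2 : ℝ) : ℂ) •
        (TemperedDistribution.smulLeftCLM ℂ fun x : Space n => Complex.ofReal (‖x‖ ^ 2))
          (Lp.toTemperedDistribution (𝓕 g : L2 n)) (hcφ'.toSchwartzMap hφ') =
        ((-(2 * Real.pi) ^ 2 : ℝ) : ℂ) • ∫ x, SchwartzMap.smulLeftCLM ℂ
          (fun x : Space n => Complex.ofReal (‖x‖ ^ 2)) (hcφ'.toSchwartzMap hφ') x •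
            (𝓕 g : L2 n) x := by
      rw [TemperedDistribution.smulLeftCLM_apply_apply, Lp.toTemperedDistribution_apply]
    refine Eq.trans ?_ ((h2.trans h3).trans ?_)
    · simp only [Lp.toTemperedDistribution_apply]
      rfl
    · rw [← integral_smul]
      refine integral_congr_ae (Eventually.of_forall fun x => ?_)
      simp only [SchwartzMap.smulLeftCLM_apply_apply hg]
      change _ • (_ • ((φ x : ℝ) : ℂ)) • _ = _
      simp only [smul_eq_mul, Complex.real_smul]
      push_cast
      ring

/-- The Fourier transform as a real-linear continuous map on `L²`. -/
def fourierCLMReal (n : ℕ) : L2 n →L[ℝ] L2 n :=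
  ((Lp.fourierTransformₗᵢ (Space n) ℂ).toContinuousLinearEquiv : L2 n →L[ℂ] L2 n).restrictScalars ℝ

theorem fourierCLMReal_apply (f : L2 n) : fourierCLMReal n f = 𝓕 f := rfl

theorem fourier_sub_L2 (f g : L2 n) : (𝓕 (f - g) : L2 n) = 𝓕 f - 𝓕 g :=
  map_sub (fourierCLMReal n) f g

/-- Turns the Picard iterates, which are polynomials in an operator, into pointwise partial sums of
a power series. -/
theorem coeFn_sum_smul_pow {A : L2 n →L[ℝ] L2 n} {m : Space n → ℝ}
    (hA : ∀ f : L2 n, A f =ᵐ[volume] fun η => (m η : ℂ) * f η) (c : ℕ → ℝ) (w : L2 n) (N : ℕ) :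
    ((∑ k ∈ Finset.range N, c k • ((-A) ^ k) w : L2 n) : Space n → ℂ) =ᵐ[volume]
      fun η => ((∑ k ∈ Finset.range N, c k * (-m η) ^ k : ℝ) : ℂ) * w η := by
  have hp : ∀ k : ℕ, ((-A) ^ k) w =ᵐ[volume] fun η => (((-m η) ^ k : ℝ) : ℂ) * w η := by
    intro k
    induction k with
    | zero => simp
    | succ k ih =>
      rw [pow_succ', mul_apply_eq_comp, neg_apply]
      filter_upwards [ih, hA (((-A) ^ k) w), Lp.coeFn_neg (A (((-A) ^ k) w))] with η h1 h2 h3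
      rw [h3, Pi.neg_apply, h2, h1]
      push_cast; ring
  induction N with
  | zero =>
    rw [Finset.sum_range_zero]
    exact (Lp.coeFn_zero ℂ 2 volume).trans (Eventually.of_forall fun η => by simp)
  | succ N ih =>
    rw [Finset.sum_range_succ]
    filter_upwards [ih, Lp.coeFn_add (∑ k ∈ Finset.range N, c k • ((-A) ^ k) w)
      (c N • ((-A) ^ N) w), Lp.coeFn_smul (c N) (((-A) ^ N) w), hp N] with η h1 h2 h3 h4
    rw [h2, Pi.add_apply, h1, h3, Pi.smul_apply, h4, Finset.sum_range_succ, Complex.real_smul]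
    push_cast; ring

theorem ae_tendsto_subseq {f : ℕ → L2 n} {g : L2 n} (h : Tendsto f atTop (𝓝 g)) :
    ∃ ns : ℕ → ℕ, StrictMono ns ∧ ∀ᵐ η, Tendsto (fun j => f (ns j) η) atTop (𝓝 (g η)) :=
  (tendstoInMeasure_of_tendsto_Lp h).exists_seq_tendsto_ae

theorem hasSum_mittagLeffler {γ t : ℝ} (hγ : 0 < γ) (ht : 0 < t) (x : ℝ) :
    HasSum (fun k : ℕ => rlKernel (γ * k + 1) t * x ^ k) (mittagLeffler γ (x * t ^ γ)) := by
  refine (congrArg (HasSum · (mittagLeffler γ (x * t ^ γ))) (funext fun k => ?_)).mpr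
    (summable_pow_div_Gamma hγ one_pos (x * t ^ γ)).hasSum
  rw [rlKernel, add_sub_cancel_right, Real.rpow_mul ht.le, Real.rpow_natCast, mul_pow]
  ring

/-- The solution formula on the Fourier side at interior times. -/
theorem IsSolution.fourier_ae_eq_of_mem_Ioo {γ T : ℝ} (hγ₀ : 0 < γ) (hγ₁ : γ < 1)
    {u : ℝ → L2 n} (hu : IsSolution γ T u) {t : ℝ} (ht : t ∈ Ioo 0 T) :
    (𝓕 (u t) : L2 n) =ᵐ[volume] fun η =>
      (mittagLeffler γ (-((2 * Real.pi) ^ 2 * ‖η‖ ^ 2) * t ^ γ) : ℂ) * (𝓕 (u 0) : L2 n) η := by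
  have key : ∀ R : ℕ, ∀ᵐ η : Space n, ‖η‖ ≤ R → (𝓕 (u t) : L2 n) η =
      (mittagLeffler γ (-((2 * Real.pi) ^ 2 * ‖η‖ ^ 2) * t ^ γ) : ℂ) * (𝓕 (u 0) : L2 n) η := by
    intro R
    -- Frequencies are cut off to a ball, on which |2πη|² is bounded and the Laplacian acts as the
    -- bounded operator -A.
    set B : Set (Space n) := {η | ‖η‖ ≤ R}
    have hB : MeasurableSet B := measurableSet_le measurable_norm measurable_const
    set χ : Space n → ℝ := B.indicator 1
    set a : Space n → ℝ := B.indicator fun η => (2 * Real.pi) ^ 2 * ‖η‖ ^ 2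
    have hχ : Measurable χ := measurable_one.indicator hB
    have ha : Measurable a := Measurable.indicator (by fun_prop) hB
    obtain ⟨P, hP⟩ := exists_multiplication_operator hχ (C := 1) (by
      intro η
      by_cases h : η ∈ B
      · simp [χ, h]
      · simp [χ, h])
    obtain ⟨A, hA⟩ := exists_multiplication_operator ha (C := (2 * Real.pi) ^ 2 * R ^ 2) (by
      intro η
      by_cases h : η ∈ B
      · simp only [a, indicator_of_mem h]
        rw [abs_of_nonneg (by positivity)]
        gcongr
        exact h
      · simp only [a, indicator_of_notMem h, abs_zero]
        positivity)
    set L : L2 n →L[ℝ] L2 n := P ∘L fourierCLMReal n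
    have hL : ∀ f : L2 n, L f =ᵐ[volume] fun η => (χ η : ℂ) * (𝓕 f : L2 n) η := fun f => hP _
    have hLD : ∀ s ∈ Ioo 0 T, L (caputoDeriv γ u s) = -A (L (u s)) := by
      intro s hs
      refine Lp.ext ?_
      filter_upwards [hL (caputoDeriv γ u s), fourier_ae_eq_of_eq_laplacian (hu.equation s hs),
        Lp.coeFn_neg (A (L (u s))), hA (L (u s)), hL (u s)] with η h1 h2 h3 h4 h5
      rw [h1, h2, h3, Pi.neg_apply, h4, h5]
      by_cases h : η ∈ B
      · simp [χ, a, h]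
      · simp [χ, h]
    have hw : ∀ t ∈ Ioo 0 T, L (u t) =
        L (u 0) - ∫ s in (0 : ℝ)..t, rlKernel γ (t - s) • A (L (u s)) := by
      intro t ht
      obtain ⟨h1, h2⟩ := integral_rlKernel_caputo hγ₀ hγ₁ ht.1
        (hu.continuousOn.mono (Icc_subset_Icc_right ht.2.le))
        (fun r hr => hu.differentiable r ⟨hr.1, hr.2.trans ht.2⟩) (hu.integrable t ht)
      have h3 := L.intervalIntegral_comp_comm h1
      rw [h2, map_sub] at h3
      have h4 : ∫ s in (0 : ℝ)..t, L (rlKernel γ (t - s) • caputoDeriv γ u s) =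
          ∫ s in (0 : ℝ)..t, -(rlKernel γ (t - s) • A (L (u s))) := by
        rw [intervalIntegral.integral_of_le ht.1.le, intervalIntegral.integral_of_le ht.1.le]
        refine setIntegral_congr_fun measurableSet_Ioc fun s hs => ?_
        simp only [map_smul]
        rw [hLD s ⟨hs.1, hs.2.trans_lt ht.2⟩, smul_neg]
      have h5 : L (u t) - L (u 0) = ∫ s in (0 : ℝ)..t, L (rlKernel γ (t - s) • caputoDeriv γ u s) :=
        h3.symm
      rw [h4, intervalIntegral.integral_neg] at h5
      rw [sub_eq_add_neg, ← h5]
      abel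
    have hlim := tendsto_picard_of_volterra hγ₀ A (w := fun s => L (u s))
      (L.continuous.comp_continuousOn hu.continuousOn) hw ht
    -- The Picard sums converge to L(u(t)) in L², hence a.e. along a subsequence; pointwise they are
    -- partial sums of the Mittag-Leffler series, so the two limits agree.
    obtain ⟨ns, hns, hae⟩ := ae_tendsto_subseq hlim
    have hsum := ae_all_iff.2 fun N => coeFn_sum_smul_pow hA
      (fun k => rlKernel (γ * k + 1) t) (L (u 0)) N
    filter_upwards [hae, hsum, hL (u t), hL (u 0)] with η h1 h2 h3 h4 hη
    have hηB : η ∈ B := hη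
    have hχη : χ η = 1 := by simp [χ, hηB]
    have haη : a η = (2 * Real.pi) ^ 2 * ‖η‖ ^ 2 := by simp [a, hηB]
    simp only [hχη, Complex.ofReal_one, one_mul] at h3 h4
    rw [← h3, ← h4]
    refine tendsto_nhds_unique h1 ?_
    simp_rw [h2, haη]
    refine Tendsto.mul_const _ ((Complex.continuous_ofReal.tendsto _).comp ?_)
    exact (hasSum_mittagLeffler hγ₀ ht.1 _).tendsto_sum_nat.comp hns.tendsto_atTop
  filter_upwards [ae_all_iff.2 key] with η h
  obtain ⟨R, hR⟩ := exists_nat_ge ‖η‖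
  exact h R hR

/-- The solution formula on the Fourier side. -/
theorem IsSolution.fourier_ae_eq {γ T : ℝ} (hγ₀ : 0 < γ) (hγ₁ : γ < 1)
    {u : ℝ → L2 n} (hu : IsSolution γ T u) {t : ℝ} (ht : t ∈ Ioc 0 T) :
    (𝓕 (u t) : L2 n) =ᵐ[volume] fun η =>
      (mittagLeffler γ (-((2 * Real.pi) ^ 2 * ‖η‖ ^ 2) * t ^ γ) : ℂ) * (𝓕 (u 0) : L2 n) η := by
  -- The equation is available only on the open interval, so t = T is reached by continuity in L².
  -- The shift by 2 keeps τ 0 = t/2 positive.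
  set τ : ℕ → ℝ := fun j => t - t / (j + 2)
  have hτ : ∀ j, τ j ∈ Ioo 0 T := by
    intro j
    have h1 : 0 < t / (j + 2) := div_pos ht.1 (by positivity)
    have h2 : t / (j + 2) < t := div_lt_self ht.1 (by linarith [(Nat.cast_nonneg j : (0 : ℝ) ≤ j)])
    exact ⟨by simp only [τ]; linarith, by simp only [τ]; linarith [ht.2]⟩
  have hτlim : Tendsto τ atTop (𝓝 t) := by
    have h : Tendsto (fun j : ℕ => t / ((j : ℝ) + 2)) atTop (𝓝 0) :=
      tendsto_const_nhds.div_atTop (tendsto_natCast_atTop_atTop.atTop_add tendsto_const_nhds)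
    simpa using h.const_sub t
  have hlim : Tendsto (fun j => fourierCLMReal n (u (τ j))) atTop (𝓝 (fourierCLMReal n (u t))) := by
    refine ((fourierCLMReal n).continuous.tendsto _).comp ?_
    refine (hu.continuousOn t ⟨ht.1.le, ht.2⟩).tendsto.comp ?_
    exact tendsto_nhdsWithin_iff.2
      ⟨hτlim, Eventually.of_forall fun j => Ioo_subset_Icc_self (hτ j)⟩
  obtain ⟨ns, hns, hae⟩ := ae_tendsto_subseq hlim
  have hall := ae_all_iff.2 fun j => hu.fourier_ae_eq_of_mem_Ioo hγ₀ hγ₁ (hτ j)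
  filter_upwards [hae, hall] with η h1 h2
  refine tendsto_nhds_unique h1 ?_
  simp only [fourierCLMReal_apply, h2]
  refine Tendsto.mul_const _ ((Complex.continuous_ofReal.tendsto _).comp ?_)
  refine ((continuous_mittagLeffler hγ₀).tendsto _).comp (Tendsto.const_mul _ ?_)
  exact ((Real.continuous_rpow_const hγ₀.le).tendsto _).comp (hτlim.comp hns.tendsto_atTop)

/-! ### The mollifier as a Fourier multiplier -/

/-- On `L¹ ∩ L²` the inverse Fourier transform of `L²` is given by the Fourier integral. -/
theorem fourierInv_toLp_ae_eq {f : Space n → ℂ} (h1 : Integrable f) (h2 : MemLp f 2 volume) :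
    (𝓕⁻ h2.toLp : L2 n) =ᵐ[volume] 𝓕⁻ f := by
  have hcont : Continuous (𝓕⁻ f) :=
    VectorFourier.fourierIntegral_continuous Real.continuous_fourierChar
      (continuous_inner (𝕜 := ℝ) (E := Space n)).neg h1
  refine ae_eq_of_integral_contDiff_smul_eq ((Lp.memLp _).locallyIntegrable one_le_two)
    hcont.locallyIntegrable ?_
  intro φ hφ hcφ
  have hcφ' : HasCompactSupport (Complex.ofRealCLM ∘ φ) := hcφ.comp_left rfl
  have hφ' : ContDiff ℝ (↑(⊤ : ℕ∞)) (Complex.ofRealCLM ∘ φ) := by fun_prop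
  set ψ : 𝓢(Space n, ℂ) := hcφ'.toSchwartzMap hφ'
  have hψ : ∀ x (z : ℂ), φ x • z = ψ x • z := fun x z => rfl
  simp_rw [hψ]
  have e1 := congrArg (fun S : 𝓢'(Space n, ℂ) => S ψ)
    (Lp.fourierInv_toTemperedDistribution_eq (h2.toLp : L2 n))
  simp only [TemperedDistribution.fourierInv_apply, Lp.toTemperedDistribution_apply] at e1
  rw [← e1]
  -- The inverse transform moves from the test function to f; the phase is symmetric, so flipping
  -- the bilinear form changes nothing.
  have e2 := VectorFourier.integral_fourierIntegral_smul_eq_flip (L := -innerₗ (Space n))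
    Real.continuous_fourierChar
    (continuous_inner (𝕜 := ℝ) (E := Space n)).neg ψ.integrable h1
    (μ := volume) (ν := volume)
  have e3 : (-innerₗ (Space n)).flip = -innerₗ (Space n) := by
    ext x y; simp [real_inner_comm]
  rw [e3] at e2
  refine Eq.trans ?_ e2
  refine integral_congr_ae ?_
  filter_upwards [h2.coeFn_toLp] with x hx
  rw [hx, SchwartzMap.fourierInv_coe]
  rfl

/-- The symbol of the mollifier in the frequency variable of `𝓕`. -/
def freqSymbol (τ s α : ℝ) (η : Space n) : ℝ := Real.exp (-τ * ‖(2 * Real.pi * α) • η‖ ^ s)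

/-- With κ = q/s, the inequality y ≤ e^y at y = τx^s/κ is raised to the power κ. The case q = 0 is
separate because of the division by κ. -/
theorem rpow_mul_exp_neg_le {τ s q x : ℝ} (hτ : 0 < τ) (hs : 0 < s) (hq : 0 ≤ q) (hx : 0 ≤ x) :
    x ^ q * Real.exp (-τ * x ^ s) ≤ (q / s / τ) ^ (q / s) := by
  rcases hq.eq_or_lt with rfl | hq
  · simp only [Real.rpow_zero, zero_div, one_mul]
    rw [Real.exp_le_one_iff]
    nlinarith [Real.rpow_nonneg hx s]
  set κ := q / s
  have hκ : 0 < κ := div_pos hq hs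
  have hxs : 0 ≤ x ^ s := Real.rpow_nonneg hx s
  have h1 : (τ * x ^ s / κ) ^ κ ≤ Real.exp (τ * x ^ s) := by
    calc (τ * x ^ s / κ) ^ κ ≤ (Real.exp (τ * x ^ s / κ)) ^ κ := by
          refine Real.rpow_le_rpow (by positivity) ?_ hκ.le
          linarith [Real.add_one_le_exp (τ * x ^ s / κ)]
      _ = Real.exp (τ * x ^ s) := by
          rw [← Real.exp_mul, div_mul_cancel₀ _ hκ.ne']
  have h2 : x ^ q = (κ / τ) ^ κ * (τ * x ^ s / κ) ^ κ := by
    rw [← Real.mul_rpow (by positivity) (by positivity),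
      show κ / τ * (τ * x ^ s / κ) = x ^ s by field_simp, ← Real.rpow_mul hx,
      mul_div_cancel₀ _ hs.ne']
  rw [h2, neg_mul, Real.exp_neg, ← div_eq_mul_inv, div_le_iff₀ (Real.exp_pos _)]
  gcongr

theorem sobolevWeight_le {q r : ℝ} (hq : 0 ≤ q) (hr : 0 ≤ r) :
    (1 + r ^ 2) ^ (q / 2) ≤ 2 ^ (q / 2) * (1 + r ^ q) := by
  have h1 : 1 + r ^ 2 ≤ 2 * (max 1 r) ^ 2 := by
    rcases le_total 1 r with h | h
    · rw [max_eq_right h]; nlinarith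
    · rw [max_eq_left h]; nlinarith
  calc (1 + r ^ 2) ^ (q / 2) ≤ (2 * (max 1 r) ^ 2) ^ (q / 2) :=
        Real.rpow_le_rpow (by positivity) h1 (by positivity)
    _ = 2 ^ (q / 2) * (max 1 r) ^ q := by
        rw [Real.mul_rpow (by positivity) (by positivity), ← Real.rpow_natCast (max 1 r) 2,
          ← Real.rpow_mul (by positivity)]
        congr 2; push_cast; ring
    _ ≤ 2 ^ (q / 2) * (1 + r ^ q) := by
        gcongr
        have : 0 ≤ r ^ q := Real.rpow_nonneg hr q
        rcases le_total 1 r with h | h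
        · rw [max_eq_right h]; linarith
        · rw [max_eq_left h, Real.one_rpow]; linarith

theorem freqSymbol_pos (τ s α : ℝ) (η : Space n) : 0 < freqSymbol τ s α η := Real.exp_pos _

theorem freqSymbol_le_one {τ : ℝ} (hτ : 0 < τ) (s α : ℝ) (η : Space n) :
    freqSymbol τ s α η ≤ 1 := by
  rw [freqSymbol, Real.exp_le_one_iff]
  nlinarith [Real.rpow_nonneg (norm_nonneg ((2 * Real.pi * α) • η)) s]

theorem measurable_freqSymbol (τ s α : ℝ) : Measurable (freqSymbol τ s α : Space n → ℝ) := by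
  unfold freqSymbol
  fun_prop

theorem norm_two_pi_mul_smul {α : ℝ} (hα : 0 ≤ α) (η : Space n) :
    ‖(2 * Real.pi * α) • η‖ = 2 * Real.pi * α * ‖η‖ := by
  rw [norm_smul, Real.norm_eq_abs, abs_of_nonneg (by positivity)]

/-- Sobolev weights are controlled by the decay of the mollifier symbol. -/
theorem sobolevWeight_mul_freqSymbol_le {τ s q : ℝ} (hτ : 0 < τ) (hs : 0 < s) (hq : 0 ≤ q) :
    ∃ C, 0 < C ∧ ∀ α, 0 < α → ∀ η : Space n,
      (1 + ‖(2 * Real.pi) • η‖ ^ 2) ^ (q / 2) * freqSymbol τ s α η ≤ C * (1 + (α ^ q)⁻¹) := by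
  refine ⟨2 ^ (q / 2) * (1 + (q / s / τ) ^ (q / s)), by positivity, fun α hα η => ?_⟩
  set r := ‖(2 * Real.pi) • η‖
  have hr : 0 ≤ r := norm_nonneg _
  have hαr : ‖(2 * Real.pi * α) • η‖ = α * r := by
    rw [mul_comm (2 * Real.pi) α, ← smul_smul, norm_smul, Real.norm_eq_abs, abs_of_pos hα]
  have h0 := freqSymbol_pos τ s α η
  have h1 := freqSymbol_le_one hτ s α η
  have h2 := rpow_mul_exp_neg_le hτ hs hq (mul_nonneg hα.le hr)
  have hαq : 0 < α ^ q := Real.rpow_pos_of_pos hα q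
  have h3 : r ^ q * freqSymbol τ s α η ≤ (q / s / τ) ^ (q / s) * (α ^ q)⁻¹ := by
    rw [Real.mul_rpow hα.le hr] at h2
    rw [freqSymbol, hαr, ← div_eq_mul_inv, le_div_iff₀ hαq]
    calc _ = α ^ q * r ^ q * Real.exp (-τ * (α * r) ^ s) := by ring
      _ ≤ _ := h2
  have hK : 0 ≤ (q / s / τ) ^ (q / s) := by positivity
  calc (1 + r ^ 2) ^ (q / 2) * freqSymbol τ s α η
      ≤ 2 ^ (q / 2) * (1 + r ^ q) * freqSymbol τ s α η := by
        gcongr; exact sobolevWeight_le hq hr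
    _ = 2 ^ (q / 2) * (freqSymbol τ s α η + r ^ q * freqSymbol τ s α η) := by ring
    _ ≤ 2 ^ (q / 2) * (1 + (q / s / τ) ^ (q / s) * (α ^ q)⁻¹) := by gcongr
    _ ≤ 2 ^ (q / 2) * ((1 + (q / s / τ) ^ (q / s)) * (1 + (α ^ q)⁻¹)) := by
        gcongr
        have : 0 ≤ (α ^ q)⁻¹ := by positivity
        nlinarith
    _ = _ := by ring

theorem integrable_freqSymbol {τ s α : ℝ} (hτ : 0 < τ) (hs : 0 < s) (hα : 0 < α) :
    Integrable (fun η : Space n => (freqSymbol τ s α η : ℂ)) := by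
  -- The order n + 1 exceeds the dimension, so the inverse weight is integrable.
  have hq : (0 : ℝ) ≤ n + 1 := by positivity
  obtain ⟨C, hC, h⟩ := sobolevWeight_mul_freqSymbol_le (n := n) hτ hs hq
  have hint := integrable_rpow_neg_one_add_norm_sq (E := Space n) (μ := volume)
    (r := (n : ℝ) + 1) (by simp)
  refine (hint.const_mul (C * (1 + (α ^ ((n : ℝ) + 1))⁻¹))).mono'
    (Complex.measurable_ofReal.comp (measurable_freqSymbol τ s α)).aestronglyMeasurable
    (Eventually.of_forall fun η => ?_)
  rw [Complex.norm_real, Real.norm_eq_abs, abs_of_pos (freqSymbol_pos _ _ _ _)]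
  have h1 : (1 + ‖η‖ ^ 2) ^ (((n : ℝ) + 1) / 2) ≤
      (1 + ‖(2 * Real.pi) • η‖ ^ 2) ^ (((n : ℝ) + 1) / 2) := by
    refine Real.rpow_le_rpow (by positivity) ?_ (by positivity)
    rw [norm_smul, Real.norm_eq_abs, abs_of_pos Real.two_pi_pos]
    have : 1 ≤ 2 * Real.pi := by linarith [Real.pi_gt_three]
    have h2 : ‖η‖ ≤ 2 * Real.pi * ‖η‖ := le_mul_of_one_le_left (norm_nonneg _) this
    gcongr
  rw [neg_div, Real.rpow_neg (by positivity), ← div_eq_mul_inv, le_div_iff₀ (by positivity),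
    mul_comm]
  exact (mul_le_mul_of_nonneg_right h1 (freqSymbol_pos _ _ _ _).le).trans (h α hα η)

theorem memLp_freqSymbol {τ s α : ℝ} (hτ : 0 < τ) (hs : 0 < s) (hα : 0 < α) :
    MemLp (fun η : Space n => (freqSymbol τ s α η : ℂ)) 2 volume := by
  have hm : AEStronglyMeasurable (fun η : Space n => (freqSymbol τ s α η : ℂ)) volume :=
    (Complex.measurable_ofReal.comp (measurable_freqSymbol τ s α)).aestronglyMeasurable
  rw [memLp_two_iff_integrable_sq_norm hm]
  refine (integrable_freqSymbol hτ hs hα).norm.mono' (hm.norm.pow 2)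
    (Eventually.of_forall fun η => ?_)
  have h0 := freqSymbol_pos τ s α η
  have h1 := freqSymbol_le_one hτ s α η
  rw [norm_pow, norm_norm, Complex.norm_real, Real.norm_eq_abs, abs_of_pos h0]
  nlinarith

theorem memLp_freqSymbol_mul {τ : ℝ} (hτ : 0 < τ) (s α : ℝ) (f : L2 n) :
    MemLp (fun η : Space n => (freqSymbol τ s α η : ℂ) * f η) 2 volume := by
  refine (Lp.memLp f).of_le_mul (c := 1)
    ((Complex.measurable_ofReal.comp (measurable_freqSymbol τ s α)).aestronglyMeasurable.mul
      (Lp.aestronglyMeasurable f)) (Eventually.of_forall fun η => ?_)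
  rw [norm_mul, Complex.norm_real, Real.norm_eq_abs, abs_of_pos (freqSymbol_pos _ _ _ _)]
  exact mul_le_mul_of_nonneg_right (freqSymbol_le_one hτ s α η) (norm_nonneg _)

theorem sqrt_two_pi_pow_sq (n : ℕ) : (√(2 * Real.pi) ^ n) * (√(2 * Real.pi) ^ n) =
    (2 * Real.pi) ^ n := by
  rw [← mul_pow, Real.mul_self_sqrt Real.two_pi_pos.le]

/-- The rescaled kernel is an inverse Fourier integral of the symbol. -/
theorem kernel_smul {τ s α : ℝ} (hα : 0 < α) (x : Space n) :
    (((α ^ n)⁻¹ : ℝ) : ℂ) * kernel τ s (α⁻¹ • x) =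
      𝓕⁻ (fun η : Space n => (freqSymbol τ s α η : ℂ)) x := by
  rw [Real.fourierInv_eq', kernel]
  have h := Measure.integral_comp_smul (volume : Measure (Space n))
    (fun ξ => (kernelHat τ s ξ : ℂ) * Complex.exp (Complex.I * (inner ℝ (α⁻¹ • x) ξ : ℝ)))
    (2 * Real.pi * α)
  have hp : 0 < 2 * Real.pi * α := by positivity
  rw [finrank_euclideanSpace_fin, abs_of_pos (by positivity)] at h
  have h' : ∫ ξ : Space n, (kernelHat τ s ξ : ℂ) *
      Complex.exp (Complex.I * (inner ℝ (α⁻¹ • x) ξ : ℝ)) =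
      (((2 * Real.pi * α) ^ n : ℝ) : ℂ) * ∫ η : Space n, (kernelHat τ s ((2 * Real.pi * α) • η) : ℂ) *
      Complex.exp (Complex.I * (inner ℝ (α⁻¹ • x) ((2 * Real.pi * α) • η) : ℝ)) := by
    rw [h, ← Complex.real_smul, smul_smul, mul_inv_cancel₀ (by positivity), one_smul]
  rw [h', ← mul_assoc, ← mul_assoc, ← integral_const_mul]
  refine integral_congr_ae (Eventually.of_forall fun η => ?_)
  have e1 : (inner ℝ (α⁻¹ • x) ((2 * Real.pi * α) • η) : ℝ) = 2 * Real.pi * inner ℝ η x := by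
    rw [inner_smul_left, inner_smul_right, real_inner_comm]
    simp only [conj_trivial]
    field_simp
  have e2 : (α ^ n)⁻¹ * (√(2 * Real.pi) ^ n)⁻¹ * (2 * Real.pi * α) ^ n *
      (√(2 * Real.pi) ^ n)⁻¹ = 1 := by
    rw [mul_pow (2 * Real.pi) α n, ← sqrt_two_pi_pow_sq n]
    field_simp
  have e3 : (((α ^ n)⁻¹ : ℝ) : ℂ) * (((√(2 * Real.pi) ^ n)⁻¹ : ℝ) : ℂ) *
      (((2 * Real.pi * α) ^ n : ℝ) : ℂ) * (((√(2 * Real.pi) ^ n)⁻¹ : ℝ) : ℂ) = 1 := by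
    exact_mod_cast e2
  simp only [e1, kernelHat, freqSymbol, smul_eq_mul]
  rw [mul_comm Complex.I]
  calc _ = ((((α ^ n)⁻¹ : ℝ) : ℂ) * (((√(2 * Real.pi) ^ n)⁻¹ : ℝ) : ℂ) *
      (((2 * Real.pi * α) ^ n : ℝ) : ℂ) * (((√(2 * Real.pi) ^ n)⁻¹ : ℝ) : ℂ)) *
      (Complex.exp (((2 * Real.pi * inner ℝ η x : ℝ) : ℂ) * Complex.I) *
        ((Real.exp (-τ * ‖(2 * Real.pi * α) • η‖ ^ s) : ℝ) : ℂ)) := by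
        rw [Complex.ofReal_mul]; ring
    _ = _ := by rw [e3, one_mul]

/-- The mollifier is a Fourier multiplier with symbol `freqSymbol`. -/
theorem mollify_ae_eq {τ s α : ℝ} (hτ : 0 < τ) (hs : 0 < s) (hα : 0 < α) (f : L2 n) :
    mollify τ s α f =ᵐ[volume] (𝓕⁻ (memLp_freqSymbol_mul hτ s α (𝓕 f)).toLp : L2 n) := by
  have hint : Integrable (fun η : Space n => (freqSymbol τ s α η : ℂ) * (𝓕 f : L2 n) η) :=
    (memLp_freqSymbol hτ hs hα).integrable_mul (Lp.memLp (𝓕 f))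
  refine EventuallyEq.trans (Eventually.of_forall fun x => ?_) (fourierInv_toLp_ae_eq hint _).symm
  set G : Space n → ℂ := fun η => (freqSymbol τ s α η : ℂ) *
    Complex.exp (((-(2 * Real.pi * inner ℝ η x) : ℝ) : ℂ) * Complex.I)
  have hGnorm : ∀ η, ‖G η‖ = ‖(freqSymbol τ s α η : ℂ)‖ := fun η => by
    simp only [G, norm_mul, Complex.norm_exp_ofReal_mul_I, mul_one]
  have hGm : AEStronglyMeasurable G volume :=
    (memLp_freqSymbol hτ hs hα).aestronglyMeasurable.mul
      (by fun_prop : Continuous fun η : Space n =>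
        Complex.exp (((-(2 * Real.pi * inner ℝ η x) : ℝ) : ℂ) * Complex.I)).aestronglyMeasurable
  have hG1 : Integrable G := (integrable_freqSymbol hτ hs hα).mono hGm
    (Eventually.of_forall fun η => (hGnorm η).le)
  have hG2 : MemLp G 2 volume := (memLp_freqSymbol hτ hs hα).mono hGm
    (Eventually.of_forall fun η => (hGnorm η).le)
  -- The convolution at x is the L² inner product of f with 𝓕⁻ G, where G is the symbol modulated by
  -- the phase of x. Plancherel moves it to the frequency side, where it is the inverse Fourier
  -- integral.
  have hinner : inner ℂ (𝓕⁻ hG2.toLp : L2 n) f = inner ℂ (hG2.toLp : L2 n) (𝓕 f : L2 n) := by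
    rw [← Lp.inner_fourier_eq, FourierTransform.fourier_fourierInv_eq]
  rw [L2.inner_def, L2.inner_def] at hinner
  have hl : mollify τ s α f x = ∫ y, inner ℂ ((𝓕⁻ hG2.toLp : L2 n) y) (f y) := by
    refine integral_congr_ae ?_
    filter_upwards [fourierInv_toLp_ae_eq hG1 hG2] with y hy
    rw [hy, kernel_smul hα, RCLike.inner_apply', Real.fourierInv_eq', Real.fourierInv_eq',
      ← integral_conj]
    congr 1
    refine integral_congr_ae (Eventually.of_forall fun η => ?_)
    simp only [G, smul_eq_mul, map_mul, Complex.conj_ofReal, ← Complex.exp_conj, Complex.conj_I]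
    rw [mul_left_comm, ← Complex.exp_add, mul_comm, inner_sub_right]
    congr 2
    push_cast; ring
  rw [hl, hinner, Real.fourierInv_eq']
  refine integral_congr_ae ?_
  filter_upwards [hG2.coeFn_toLp] with η hη
  rw [hη, RCLike.inner_apply']
  simp only [G, smul_eq_mul, map_mul, Complex.conj_ofReal, ← Complex.exp_conj, Complex.conj_I]
  rw [← mul_assoc, mul_comm (Complex.exp _)]
  congr 3
  push_cast; ring

/-- The discrepancy on the Fourier side. -/
theorem discrepancy_eq {τ s α : ℝ} (hτ : 0 < τ) (hs : 0 < s) (hα : 0 < α) (g : L2 n) :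
    discrepancy τ s α g =
      eLpNorm (fun η => ((1 - freqSymbol τ s α η : ℝ) : ℂ) * (𝓕 g : L2 n) η) 2 volume := by
  set N : L2 n := (memLp_freqSymbol_mul hτ s α (𝓕 g)).toLp
  have h1 : discrepancy τ s α g = ‖g - (𝓕⁻ N : L2 n)‖ₑ := by
    rw [Lp.enorm_def, discrepancy]
    refine eLpNorm_congr_ae ?_
    filter_upwards [mollify_ae_eq hτ hs hα g, Lp.coeFn_sub g (𝓕⁻ N)] with x h2 h3
    rw [h3, Pi.sub_apply, h2]
  have h4 : ‖g - (𝓕⁻ N : L2 n)‖ₑ = ‖(𝓕 g : L2 n) - N‖ₑ := by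
    rw [← ofReal_norm, ← ofReal_norm, ← Lp.norm_fourier_eq (g - 𝓕⁻ N), fourier_sub_L2,
      FourierTransform.fourier_fourierInv_eq]
  rw [h1, h4, Lp.enorm_def]
  refine eLpNorm_congr_ae ?_
  filter_upwards [Lp.coeFn_sub (𝓕 g) N, (memLp_freqSymbol_mul hτ s α (𝓕 g)).coeFn_toLp] with η h2 h3
  rw [h2, Pi.sub_apply, h3]
  push_cast; ring

/-! ### Monotonicity of the discrepancy and the Morozov parameter -/

theorem one_sub_freqSymbol_nonneg {τ : ℝ} (hτ : 0 < τ) (s α : ℝ) (η : Space n) :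
    0 ≤ 1 - freqSymbol τ s α η := sub_nonneg.2 (freqSymbol_le_one hτ s α η)

theorem continuous_freqSymbol {τ s : ℝ} (hs : 0 < s) (η : Space n) :
    Continuous fun α => freqSymbol τ s α η := by
  unfold freqSymbol
  refine Real.continuous_exp.comp (continuous_const.mul ?_)
  exact (Real.continuous_rpow_const hs.le).comp (by fun_prop)

theorem freqSymbol_lt {τ s α β : ℝ} (hτ : 0 < τ) (hs : 0 < s) (hα : 0 ≤ α) (hαβ : α < β)
    {η : Space n} (hη : η ≠ 0) : freqSymbol τ s β η < freqSymbol τ s α η := by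
  have hη' := norm_pos_iff.2 hη
  rw [freqSymbol, freqSymbol, Real.exp_lt_exp, norm_two_pi_mul_smul hα,
    norm_two_pi_mul_smul (hα.trans hαβ.le), neg_mul, neg_mul, neg_lt_neg_iff]
  gcongr

theorem tendsto_freqSymbol {τ s : ℝ} (hτ : 0 < τ) (hs : 0 < s) {η : Space n} (hη : η ≠ 0) :
    Tendsto (fun α => freqSymbol τ s α η) atTop (𝓝 0) := by
  have hη' := norm_pos_iff.2 hη
  have h1 : Tendsto (fun α : ℝ => 2 * Real.pi * α * ‖η‖) atTop atTop :=
    (tendsto_id.const_mul_atTop Real.two_pi_pos).atTop_mul_const hη'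
  have h2 := ((tendsto_rpow_atTop hs).comp h1).const_mul_atTop hτ
  refine (Real.tendsto_exp_neg_atTop_nhds_zero.comp h2).congr' ?_
  filter_upwards [eventually_ge_atTop 0] with α hα
  rw [freqSymbol, norm_two_pi_mul_smul hα, Function.comp_apply, Function.comp_apply, neg_mul]

/-- The squared discrepancy on the Fourier side. -/
def sqDiscrepancy (τ s : ℝ) (G : L2 n) (α : ℝ) : ℝ :=
  ∫ η, ((1 - freqSymbol τ s α η) * ‖G η‖) ^ 2

theorem integrable_norm_sq (G : L2 n) : Integrable fun η => ‖G η‖ ^ 2 :=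
  (memLp_two_iff_integrable_sq_norm (Lp.aestronglyMeasurable G)).1 (Lp.memLp G)

theorem aestronglyMeasurable_sqDiscrepancy (τ s : ℝ) (G : L2 n) (α : ℝ) :
    AEStronglyMeasurable (fun η => ((1 - freqSymbol τ s α η) * ‖G η‖) ^ 2) volume :=
  ((measurable_const.sub (measurable_freqSymbol τ s α)).aestronglyMeasurable.mul
    (Lp.aestronglyMeasurable G).norm).pow 2

theorem sqDiscrepancy_bound {τ : ℝ} (hτ : 0 < τ) (s : ℝ) (G : L2 n) (α : ℝ) (η : Space n) :
    ‖((1 - freqSymbol τ s α η) * ‖G η‖) ^ 2‖ ≤ ‖G η‖ ^ 2 := by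
  have h0 := one_sub_freqSymbol_nonneg hτ s α η
  have h1 := freqSymbol_pos τ s α η
  rw [norm_pow, norm_mul, norm_norm, Real.norm_eq_abs, abs_of_nonneg h0]
  gcongr
  exact mul_le_of_le_one_left (norm_nonneg _) (by linarith)

theorem integrable_sqDiscrepancy {τ : ℝ} (hτ : 0 < τ) (s : ℝ) (G : L2 n) (α : ℝ) :
    Integrable fun η => ((1 - freqSymbol τ s α η) * ‖G η‖) ^ 2 :=
  (integrable_norm_sq G).mono' (aestronglyMeasurable_sqDiscrepancy τ s G α)
    (Eventually.of_forall (sqDiscrepancy_bound hτ s G α))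

theorem continuous_sqDiscrepancy {τ s : ℝ} (hτ : 0 < τ) (hs : 0 < s) (G : L2 n) :
    Continuous (sqDiscrepancy τ s G) := by
  refine continuous_of_dominated (aestronglyMeasurable_sqDiscrepancy τ s G)
    (fun α => Eventually.of_forall (sqDiscrepancy_bound hτ s G α)) (integrable_norm_sq G)
    (Eventually.of_forall fun η => ?_)
  exact ((continuous_const.sub (continuous_freqSymbol hs η)).mul_const _).pow 2

theorem sqDiscrepancy_zero {τ s : ℝ} (hs : 0 < s) (G : L2 n) : sqDiscrepancy τ s G 0 = 0 := by
  simp [sqDiscrepancy, freqSymbol, hs.ne']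

theorem tendsto_sqDiscrepancy (hn : 1 ≤ n) {τ s : ℝ} (hτ : 0 < τ) (hs : 0 < s) (G : L2 n) :
    Tendsto (sqDiscrepancy τ s G) atTop (𝓝 (∫ η, ‖G η‖ ^ 2)) := by
  have : Nonempty (Fin n) := ⟨⟨0, hn⟩⟩
  refine tendsto_integral_filter_of_dominated_convergence _
    (Eventually.of_forall (aestronglyMeasurable_sqDiscrepancy τ s G))
    (Eventually.of_forall fun α => Eventually.of_forall (sqDiscrepancy_bound hτ s G α))
    (integrable_norm_sq G) ?_
  -- At η = 0 the symbol equals 1 for every α; this point is null because n ≥ 1.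
  filter_upwards [Measure.ae_ne volume (0 : Space n)] with η hη
  simpa using (((tendsto_freqSymbol hτ hs hη).const_sub 1).mul_const ‖G η‖).pow 2

theorem strictMonoOn_sqDiscrepancy (hn : 1 ≤ n) {τ s : ℝ} (hτ : 0 < τ) (hs : 0 < s) {G : L2 n}
    (hG : G ≠ 0) : StrictMonoOn (sqDiscrepancy τ s G) (Ici 0) := by
  have : Nonempty (Fin n) := ⟨⟨0, hn⟩⟩
  intro α hα β hβ hαβ
  have hle : ∀ η : Space n, freqSymbol τ s β η ≤ freqSymbol τ s α η := by
    intro η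
    by_cases h : η = 0
    · simp [freqSymbol, h]
    · exact (freqSymbol_lt hτ hs hα hαβ h).le
  have hle' : ∀ η : Space n, ((1 - freqSymbol τ s α η) * ‖G η‖) ^ 2 ≤
      ((1 - freqSymbol τ s β η) * ‖G η‖) ^ 2 := by
    intro η
    have h0 := one_sub_freqSymbol_nonneg hτ s α η
    gcongr
    exact hle η
  have hα' := integrable_sqDiscrepancy hτ s G α
  have hβ' := integrable_sqDiscrepancy hτ s G β
  refine lt_of_le_of_ne (integral_mono hα' hβ' hle') fun h => hG ?_
  -- Equal integrals of ordered integrands would force a.e. equality, but the integrands differ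
  -- strictly wherever η ≠ 0 and G η ≠ 0.
  have h1 := (integral_eq_iff_of_ae_le hα' hβ' (Eventually.of_forall hle')).1 h
  refine (Lp.eq_zero_iff_ae_eq_zero).2 ?_
  filter_upwards [h1, Measure.ae_ne volume (0 : Space n)] with η h2 h3
  by_contra h4
  have h5 : 0 < ‖G η‖ := norm_pos_iff.2 h4
  have h6 := one_sub_freqSymbol_nonneg hτ s α η
  have h7 := freqSymbol_lt hτ hs hα hαβ h3
  refine (pow_lt_pow_left₀ ?_ (by positivity) two_ne_zero).ne h2
  gcongr

theorem memLp_one_sub_freqSymbol_mul {τ : ℝ} (hτ : 0 < τ) (s α : ℝ) (f : L2 n) :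
    MemLp (fun η : Space n => ((1 - freqSymbol τ s α η : ℝ) : ℂ) * f η) 2 volume := by
  convert! (Lp.memLp f).sub (memLp_freqSymbol_mul hτ s α f) using 1
  funext η
  rw [Pi.sub_apply]; push_cast; ring

theorem discrepancy_eq_sqrt {τ s α : ℝ} (hτ : 0 < τ) (hs : 0 < s) (hα : 0 < α) (g : L2 n) :
    discrepancy τ s α g = ENNReal.ofReal (√(sqDiscrepancy τ s (𝓕 g) α)) := by
  rw [discrepancy_eq hτ hs hα, (memLp_one_sub_freqSymbol_mul hτ s α (𝓕 g)).eLpNorm_eq_integral_rpow_norm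
    two_ne_zero ENNReal.ofNat_ne_top, Real.sqrt_eq_rpow, sqDiscrepancy]
  simp only [ENNReal.toReal_ofNat, Real.rpow_ofNat, one_div]
  congr 3
  funext η
  rw [norm_mul, Complex.norm_real, Real.norm_eq_abs,
    abs_of_nonneg (one_sub_freqSymbol_nonneg hτ s α η)]

theorem norm_sq_eq_integral (G : L2 n) : ‖G‖ ^ 2 = ∫ η, ‖G η‖ ^ 2 := by
  have h := L2.inner_def (𝕜 := ℂ) G G
  rw [inner_self_eq_norm_sq_to_K] at h
  simp_rw [inner_self_eq_norm_sq_to_K] at h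
  refine Complex.ofReal_injective ?_
  rw [← integral_complex_ofReal]
  push_cast
  exact h

/-- Existence, uniqueness and characterisation of the Morozov parameter. -/
theorem exists_morozov (hn : 1 ≤ n) {τ s d : ℝ} (hτ : 0 < τ) (hs : 0 < s) {g : L2 n}
    (hd : 0 < d) (hdg : d < ‖g‖) :
    ∃ α₀ : ℝ, 0 < α₀ ∧ ∀ α, 0 < α →
      (discrepancy τ s α g < ENNReal.ofReal d ↔ α < α₀) ∧
      (discrepancy τ s α g = ENNReal.ofReal d ↔ α = α₀) := by
  set Φ := sqDiscrepancy τ s (𝓕 g : L2 n)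
  have hG : (𝓕 g : L2 n) ≠ 0 := by
    rw [← norm_pos_iff, Lp.norm_fourier_eq]; linarith
  have hmono := strictMonoOn_sqDiscrepancy hn hτ hs hG
  have hlim := tendsto_sqDiscrepancy hn hτ hs (𝓕 g : L2 n)
  rw [← norm_sq_eq_integral, Lp.norm_fourier_eq] at hlim
  obtain ⟨N, hN, hN0⟩ := ((hlim.eventually_const_lt (show d ^ 2 < ‖g‖ ^ 2 by gcongr)).and
    (eventually_ge_atTop 0)).exists
  have hΦ0 : Φ 0 = 0 := sqDiscrepancy_zero hs _
  obtain ⟨α₀, hα₀, hα₀d⟩ := intermediate_value_Icc hN0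
    (continuous_sqDiscrepancy hτ hs (𝓕 g : L2 n)).continuousOn
    (show d ^ 2 ∈ Icc (Φ 0) (Φ N) from ⟨by rw [hΦ0]; positivity, hN.le⟩)
  have hpos : 0 < α₀ := by
    rcases hα₀.1.eq_or_lt with h | h
    · rw [← h] at hα₀d
      have : (0 : ℝ) < d ^ 2 := by positivity
      exact absurd (hα₀d.symm.trans hΦ0) this.ne'
    · exact h
  refine ⟨α₀, hpos, fun α hα => ?_⟩
  have hm : (Φ α < Φ α₀ ↔ α < α₀) ∧ (Φ α = Φ α₀ ↔ α = α₀) :=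
    ⟨hmono.lt_iff_lt hα.le hpos.le, hmono.injOn.eq_iff hα.le hpos.le⟩
  have hnn : 0 ≤ Φ α := integral_nonneg fun η => sq_nonneg _
  rw [discrepancy_eq_sqrt hτ hs hα]
  rw [← hm.1, ← hm.2, show Φ α₀ = d ^ 2 from hα₀d]
  constructor
  · rw [ENNReal.ofReal_lt_ofReal_iff hd, Real.sqrt_lt' hd]
  · rw [ENNReal.ofReal_eq_ofReal_iff (Real.sqrt_nonneg _) hd.le, Real.sqrt_eq_iff_eq_sq hnn hd.le]

theorem morozovSet_eq (hn : 1 ≤ n) {τ s θ δ : ℝ} (hτ : 0 < τ) (hs : 0 < s) {g : L2 n}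
    (hd : 0 < θ * δ) (hdg : θ * δ < ‖g‖) :
    IsLUB (morozovSet τ s θ δ g) (morozovParameter τ s θ δ g) ∧
      0 < morozovParameter τ s θ δ g ∧
      ∀ α : ℝ, 0 < α → (discrepancy τ s α g = ENNReal.ofReal (θ * δ) ↔
        α = morozovParameter τ s θ δ g) := by
  obtain ⟨α₀, h0, h⟩ := exists_morozov hn hτ hs hd hdg
  have hset : morozovSet τ s θ δ g = Ioo 0 α₀ := by
    ext α
    constructor
    · rintro ⟨h1, h2⟩; exact ⟨h1, (h α h1).1.1 h2⟩
    · rintro ⟨h1, h2⟩; exact ⟨h1, (h α h1).1.2 h2⟩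
  have hpar : morozovParameter τ s θ δ g = α₀ := by
    rw [morozovParameter, hset, csSup_Ioo h0]
  rw [hpar, hset]
  exact ⟨isLUB_Ioo h0, h0, fun α hα => (h α hα).2⟩

/-! ### Sobolev norms and the regularised solution in the frequency variable -/

theorem sqrt_two_pi_pow_pos (n : ℕ) : 0 < √(2 * Real.pi) ^ n :=
  pow_pos (Real.sqrt_pos.2 Real.two_pi_pos) n

theorem two_pi_smul_inv_smul (ξ : Space n) : (2 * Real.pi) • (2 * Real.pi)⁻¹ • ξ = ξ := by
  rw [smul_smul, mul_inv_cancel₀ Real.two_pi_pos.ne', one_smul]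

/-- Unitarity of the change of the frequency variable. -/
theorem eLpNorm_rescale {f : Space n → ℂ} (hf : AEStronglyMeasurable f volume) :
    eLpNorm (fun ξ => (((√(2 * Real.pi) ^ n)⁻¹ : ℝ) : ℂ) * f ((2 * Real.pi)⁻¹ • ξ)) 2 volume =
      eLpNorm f 2 volume := by
  have hr : (2 * Real.pi)⁻¹ ≠ 0 := inv_ne_zero Real.two_pi_pos.ne'
  have hmap := Measure.map_addHaar_smul (volume : Measure (Space n)) hr
  have hc := sqrt_two_pi_pow_pos n
  have h1 : eLpNorm (fun ξ : Space n => f ((2 * Real.pi)⁻¹ • ξ)) 2 volume =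
      eLpNorm f 2 (Measure.map (fun ξ : Space n => (2 * Real.pi)⁻¹ • ξ) volume) := by
    rw [eLpNorm_map_measure _ (by fun_prop)]
    · rfl
    · rw [hmap]; exact hf.smul_measure _
  have h2 : (fun ξ : Space n => (((√(2 * Real.pi) ^ n)⁻¹ : ℝ) : ℂ) * f ((2 * Real.pi)⁻¹ • ξ)) =
      (((√(2 * Real.pi) ^ n)⁻¹ : ℝ) : ℂ) • fun ξ : Space n => f ((2 * Real.pi)⁻¹ • ξ) := rfl
  rw [h2, eLpNorm_const_smul, h1, hmap, eLpNorm_smul_measure_of_ne_top ENNReal.ofNat_ne_top,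
    smul_eq_mul, ← mul_assoc, ← ofReal_norm, Complex.norm_real, Real.norm_eq_abs,
    finrank_euclideanSpace_fin, inv_pow, inv_inv, abs_of_pos (inv_pos.2 hc),
    abs_of_pos (pow_pos Real.two_pi_pos n), ← sqrt_two_pi_pow_sq n,
    ENNReal.ofReal_rpow_of_pos (mul_pos hc hc), ← ENNReal.ofReal_mul (inv_pos.2 hc).le]
  have h3 : (√(2 * Real.pi) ^ n * √(2 * Real.pi) ^ n) ^ (1 / (2 : ℝ≥0∞)).toReal =
      √(2 * Real.pi) ^ n := by
    rw [ENNReal.toReal_div, ENNReal.toReal_one, ENNReal.toReal_ofNat, ← Real.sqrt_eq_rpow,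
      Real.sqrt_mul_self hc.le]
  rw [h3, inv_mul_cancel₀ hc.ne', ENNReal.ofReal_one, one_mul]

/-- The Sobolev weight in the frequency variable of `𝓕`. -/
def sobolevWeight (l : ℝ) (η : Space n) : ℝ := (1 + ‖(2 * Real.pi) • η‖ ^ 2) ^ (l / 2)

theorem sobolevWeight_pos (l : ℝ) (η : Space n) : 0 < sobolevWeight l η :=
  Real.rpow_pos_of_pos (by positivity) _

theorem one_le_sobolevWeight {l : ℝ} (hl : 0 ≤ l) (η : Space n) : 1 ≤ sobolevWeight l η :=
  Real.one_le_rpow (by nlinarith [sq_nonneg ‖(2 * Real.pi) • η‖]) (by positivity)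

theorem measurable_sobolevWeight (l : ℝ) : Measurable (sobolevWeight l : Space n → ℝ) := by
  unfold sobolevWeight
  fun_prop

theorem aestronglyMeasurable_ofReal_mul {m : Space n → ℝ} (hm : Measurable m) {f : Space n → ℂ}
    (hf : AEStronglyMeasurable f volume) :
    AEStronglyMeasurable (fun η => (m η : ℂ) * f η) volume :=
  (Complex.measurable_ofReal.comp hm).aestronglyMeasurable.mul hf

theorem sobolevNorm_eq (l : ℝ) (f : L2 n) :
    sobolevNorm l f = eLpNorm (fun η => (sobolevWeight l η : ℂ) * (𝓕 f : L2 n) η) 2 volume := by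
  rw [← eLpNorm_rescale (aestronglyMeasurable_ofReal_mul (measurable_sobolevWeight l)
    (Lp.aestronglyMeasurable (𝓕 f))), sobolevNorm]
  congr 1
  funext ξ
  rw [fourierL2, sobolevWeight, two_pi_smul_inv_smul]
  ring

theorem sobolevNorm_zero (f : L2 n) : sobolevNorm 0 f = ENNReal.ofReal ‖f‖ := by
  rw [sobolevNorm_eq, ← Lp.norm_fourier_eq, ofReal_norm, Lp.enorm_def]
  simp [sobolevWeight]

/-- The ratio of Mittag-Leffler functions which transports the data at time `T` to time `t`. -/
def timeRatio (γ T t : ℝ) (η : Space n) : ℝ :=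
  mittagLeffler γ (-‖(2 * Real.pi) • η‖ ^ 2 * t ^ γ) /
    mittagLeffler γ (-‖(2 * Real.pi) • η‖ ^ 2 * T ^ γ)

theorem measurable_timeRatio {γ : ℝ} (hγ : 0 < γ) (T t : ℝ) :
    Measurable (timeRatio γ T t : Space n → ℝ) := by
  unfold timeRatio
  have h := (continuous_mittagLeffler hγ).measurable
  exact (h.comp (by fun_prop)).div (h.comp (by fun_prop))

theorem mittagLeffler_neg_pos {γ x : ℝ} (hγ₀ : 0 < γ) (hγ₁ : γ < 1) (hx : 0 ≤ x) :
    0 < mittagLeffler γ (-x) := by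
  refine lt_of_lt_of_le ?_ (mittagLeffler_neg_bounds hγ₀ hγ₁ hx).1
  have := Real.Gamma_pos_of_pos (sub_pos.2 hγ₁)
  positivity

theorem timeRatio_nonneg {γ T t : ℝ} (hγ₀ : 0 < γ) (hγ₁ : γ < 1) (hT : 0 ≤ T) (ht : 0 ≤ t)
    (η : Space n) : 0 ≤ timeRatio γ T t η := by
  unfold timeRatio
  rw [neg_mul, neg_mul]
  exact div_nonneg (mittagLeffler_neg_pos hγ₀ hγ₁ (by positivity)).le
    (mittagLeffler_neg_pos hγ₀ hγ₁ (by positivity)).le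

/-- A bound that survives t = 0: the numerator is at most 1 and the denominator decays like an
inverse second-order weight. The decay of the mollifier symbol absorbs this loss, so the regularised
solution lies in L² for every t in [0, T]. -/
theorem timeRatio_le_sobolevWeight {γ T t : ℝ} (hγ₀ : 0 < γ) (hγ₁ : γ < 1) (hT : 0 ≤ T)
    (ht : 0 ≤ t) (η : Space n) :
    timeRatio γ T t η ≤ (1 + Real.Gamma (1 - γ) * T ^ γ) * sobolevWeight 2 η := by
  have hΓ₁ := Real.Gamma_pos_of_pos (sub_pos.2 hγ₁)
  have hΓ₂ := Real.Gamma_pos_of_pos (show 0 < γ + 1 by linarith)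
  set x := ‖(2 * Real.pi) • η‖ ^ 2
  have hx : 0 ≤ x := by positivity
  have hw : sobolevWeight 2 η = 1 + x := by simp [sobolevWeight, x]
  have hTγ : 0 ≤ T ^ γ := Real.rpow_nonneg hT γ
  have h1 := (mittagLeffler_neg_bounds hγ₀ hγ₁ (x := x * T ^ γ) (by positivity)).1
  have h2 : mittagLeffler γ (-(x * t ^ γ)) ≤ 1 :=
    (mittagLeffler_neg_bounds hγ₀ hγ₁ (x := x * t ^ γ) (by positivity)).2.trans
      (inv_le_one_of_one_le₀ (by
        have : 0 ≤ x * t ^ γ / Real.Gamma (γ + 1) := by positivity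
        linarith))
  have h3 := mittagLeffler_neg_pos hγ₀ hγ₁ (x := x * T ^ γ) (by positivity)
  rw [inv_le_iff_one_le_mul₀ (by positivity)] at h1
  rw [timeRatio, hw, neg_mul, neg_mul, div_le_iff₀ h3]
  refine h2.trans (h1.trans ?_)
  rw [mul_comm]
  gcongr
  have : 0 ≤ Real.Gamma (1 - γ) * T ^ γ := by positivity
  nlinarith

/-- Numerator and denominator decay at the same rate 1/|ξ|², so for t > 0 the ratio is bounded
uniformly in frequency; this is the source of the factor t^(-γ). -/
theorem timeRatio_le {γ T t : ℝ} (hγ₀ : 0 < γ) (hγ₁ : γ < 1) (ht : t ∈ Ioc 0 T) (η : Space n) :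
    timeRatio γ T t η ≤ (1 + Real.Gamma (1 - γ) * Real.Gamma (γ + 1)) * T ^ γ / t ^ γ := by
  have hΓ₁ := Real.Gamma_pos_of_pos (sub_pos.2 hγ₁)
  have hΓ₂ := Real.Gamma_pos_of_pos (show 0 < γ + 1 by linarith)
  have hT : 0 < T := ht.1.trans_le ht.2
  set x := ‖(2 * Real.pi) • η‖ ^ 2
  have hx : 0 ≤ x := by positivity
  have hTγ : 0 < T ^ γ := Real.rpow_pos_of_pos hT γ
  have htγ : 0 < t ^ γ := Real.rpow_pos_of_pos ht.1 γ
  have htT : t ^ γ ≤ T ^ γ := Real.rpow_le_rpow ht.1.le ht.2 hγ₀.le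
  have h1 := (mittagLeffler_neg_bounds hγ₀ hγ₁ (x := x * T ^ γ) (by positivity)).1
  have h2 := (mittagLeffler_neg_bounds hγ₀ hγ₁ (x := x * t ^ γ) (by positivity)).2
  have h3 := mittagLeffler_neg_pos hγ₀ hγ₁ (x := x * T ^ γ) (by positivity)
  rw [inv_le_iff_one_le_mul₀ (by positivity)] at h1
  rw [timeRatio, neg_mul, neg_mul, div_le_iff₀ h3]
  refine h2.trans ?_
  rw [inv_le_iff_one_le_mul₀ (by positivity)]
  -- On expanding the right side, one term is T^γ ≥ t^γ and another equals the remaining term on the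
  -- left; the rest is nonnegative.
  have h4 : t ^ γ * (1 + Real.Gamma (1 - γ) * (x * T ^ γ)) ≤
      (1 + Real.Gamma (1 - γ) * Real.Gamma (γ + 1)) * T ^ γ *
        (1 + x * t ^ γ / Real.Gamma (γ + 1)) := by
    have e : (1 + Real.Gamma (1 - γ) * Real.Gamma (γ + 1)) * T ^ γ *
        (1 + x * t ^ γ / Real.Gamma (γ + 1)) = T ^ γ + Real.Gamma (1 - γ) * (x * T ^ γ) * t ^ γ +
        (Real.Gamma (1 - γ) * Real.Gamma (γ + 1) * T ^ γ + T ^ γ * x * t ^ γ / Real.Gamma (γ + 1)) := by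
      field_simp
      ring
    rw [e]
    have : 0 ≤ Real.Gamma (1 - γ) * Real.Gamma (γ + 1) * T ^ γ +
      T ^ γ * x * t ^ γ / Real.Gamma (γ + 1) := by positivity
    linarith
  calc (1 : ℝ) ≤ mittagLeffler γ (-(x * T ^ γ)) * (1 + Real.Gamma (1 - γ) * (x * T ^ γ)) := h1
    _ = mittagLeffler γ (-(x * T ^ γ)) / t ^ γ *
        (t ^ γ * (1 + Real.Gamma (1 - γ) * (x * T ^ γ))) := by field_simp
    _ ≤ mittagLeffler γ (-(x * T ^ γ)) / t ^ γ *
        ((1 + Real.Gamma (1 - γ) * Real.Gamma (γ + 1)) * T ^ γ *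
        (1 + x * t ^ γ / Real.Gamma (γ + 1))) := by gcongr
    _ = _ := by ring

/-- The regularised solution in the frequency variable of `𝓕`. -/
theorem regularizedHat_smul (γ T τ s α : ℝ) (g : L2 n) (t : ℝ) (η : Space n) :
    ((√(2 * Real.pi) ^ n : ℝ) : ℂ) * regularizedHat γ T τ s α g t ((2 * Real.pi) • η) =
      ((timeRatio γ T t η * freqSymbol τ s α η : ℝ) : ℂ) * (𝓕 g : L2 n) η := by
  have hc := sqrt_two_pi_pow_pos n
  have hη : (2 * Real.pi)⁻¹ • (2 * Real.pi) • η = η := by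
    rw [smul_smul, inv_mul_cancel₀ Real.two_pi_pos.ne', one_smul]
  rw [regularizedHat, fourierL2, hη, kernelHat, smul_smul, ← mul_assoc, ← mul_assoc,
    ← Complex.ofReal_mul, ← Complex.ofReal_mul]
  congr 2
  rw [timeRatio, freqSymbol, mul_comm α]
  field_simp

theorem memLp_timeRatio_mul {γ T τ s α t : ℝ} (hγ₀ : 0 < γ) (hγ₁ : γ < 1) (hτ : 0 < τ)
    (hs : 0 < s) (hα : 0 < α) (hT : 0 ≤ T) (ht : 0 ≤ t) (f : L2 n) :
    MemLp (fun η => ((timeRatio γ T t η * freqSymbol τ s α η : ℝ) : ℂ) * f η) 2 volume := by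
  obtain ⟨C, hC, h⟩ := sobolevWeight_mul_freqSymbol_le (n := n) hτ hs zero_le_two
  have hΓ₁ := Real.Gamma_pos_of_pos (sub_pos.2 hγ₁)
  have hTγ : 0 ≤ T ^ γ := Real.rpow_nonneg hT γ
  refine (Lp.memLp f).of_le_mul
    (c := (1 + Real.Gamma (1 - γ) * T ^ γ) * (C * (1 + (α ^ (2 : ℝ))⁻¹)))
    (aestronglyMeasurable_ofReal_mul ((measurable_timeRatio hγ₀ T t).mul
      (measurable_freqSymbol τ s α)) (Lp.aestronglyMeasurable f)) (Eventually.of_forall fun η => ?_)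
  have h1 := timeRatio_nonneg hγ₀ hγ₁ hT ht η
  have h2 := freqSymbol_pos τ s α η
  rw [norm_mul, Complex.norm_real, Real.norm_eq_abs, abs_of_nonneg (by positivity)]
  refine mul_le_mul_of_nonneg_right ?_ (norm_nonneg _)
  calc timeRatio γ T t η * freqSymbol τ s α η
      ≤ (1 + Real.Gamma (1 - γ) * T ^ γ) * sobolevWeight 2 η * freqSymbol τ s α η := by
        gcongr; exact timeRatio_le_sobolevWeight hγ₀ hγ₁ hT ht η
    _ = (1 + Real.Gamma (1 - γ) * T ^ γ) * (sobolevWeight 2 η * freqSymbol τ s α η) := by ring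
    _ ≤ _ := mul_le_mul_of_nonneg_left (h α hα η) (by positivity)

theorem fourier_regularizedSolution {γ T τ s α t : ℝ} (hγ₀ : 0 < γ) (hγ₁ : γ < 1) (hτ : 0 < τ)
    (hs : 0 < s) (hα : 0 < α) (hT : 0 ≤ T) (ht : 0 ≤ t) (g : L2 n) :
    (𝓕 (regularizedSolution γ T τ s α g t) : L2 n) =ᵐ[volume]
      fun η => ((timeRatio γ T t η * freqSymbol τ s α η : ℝ) : ℂ) * (𝓕 g : L2 n) η := by
  have hm := memLp_timeRatio_mul hγ₀ hγ₁ hτ hs hα hT ht (𝓕 g : L2 n)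
  simp_rw [← regularizedHat_smul] at hm ⊢
  rw [regularizedSolution, ofFourierL2, dif_pos hm, FourierTransform.fourier_fourierInv_eq]
  exact hm.coeFn_toLp

theorem fourierL2_regularizedSolution {γ T τ s α t : ℝ} (hγ₀ : 0 < γ) (hγ₁ : γ < 1) (hτ : 0 < τ)
    (hs : 0 < s) (hα : 0 < α) (hT : 0 ≤ T) (ht : 0 ≤ t) (g : L2 n) :
    fourierL2 (regularizedSolution γ T τ s α g t) =ᵐ[volume] regularizedHat γ T τ s α g t := by
  have hq := Measure.quasiMeasurePreserving_smul (volume : Measure (Space n))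
    (inv_ne_zero Real.two_pi_pos.ne')
  filter_upwards [hq.ae (fourier_regularizedSolution hγ₀ hγ₁ hτ hs hα hT ht g)] with ξ h
  have hc : ((√(2 * Real.pi) ^ n : ℝ) : ℂ) ≠ 0 :=
    Complex.ofReal_ne_zero.2 (sqrt_two_pi_pow_pos n).ne'
  rw [fourierL2, h, ← regularizedHat_smul, two_pi_smul_inv_smul, Complex.ofReal_inv,
    inv_mul_cancel_left₀ hc]

/-! ### The error estimate -/

theorem eLpNorm_le_of_norm_le_add {f g₁ g₂ : Space n → ℂ} {a b x y : ℝ} (ha : 0 ≤ a) (hb : 0 ≤ b)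
    (hx : 0 ≤ x) (hy : 0 ≤ y) (h₁ : AEStronglyMeasurable g₁ volume)
    (h₂ : AEStronglyMeasurable g₂ volume) (hx' : eLpNorm g₁ 2 volume ≤ ENNReal.ofReal x)
    (hy' : eLpNorm g₂ 2 volume ≤ ENNReal.ofReal y)
    (h : ∀ᵐ η, ‖f η‖ ≤ a * ‖g₁ η‖ + b * ‖g₂ η‖) :
    eLpNorm f 2 volume ≤ ENNReal.ofReal (a * x + b * y) := by
  have e : ∀ (c z : ℝ) (g : Space n → ℂ), 0 ≤ c → eLpNorm g 2 volume ≤ ENNReal.ofReal z →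
      eLpNorm (fun η => c * ‖g η‖) 2 volume ≤ ENNReal.ofReal (c * z) := by
    intro c z g hc hz
    rw [show (fun η => c * ‖g η‖) = c • fun η => ‖g η‖ from rfl, eLpNorm_const_smul, eLpNorm_norm,
      ENNReal.ofReal_mul hc, Real.enorm_of_nonneg hc]
    gcongr
  calc eLpNorm f 2 volume ≤ eLpNorm ((fun η => a * ‖g₁ η‖) + fun η => b * ‖g₂ η‖) 2 volume :=
        eLpNorm_mono_ae_real h
    _ ≤ eLpNorm (fun η => a * ‖g₁ η‖) 2 volume + eLpNorm (fun η => b * ‖g₂ η‖) 2 volume :=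
        eLpNorm_add_le (h₁.norm.const_mul a) (h₂.norm.const_mul b) one_le_two
    _ ≤ ENNReal.ofReal (a * x) + ENNReal.ofReal (b * y) :=
        add_le_add (e a x g₁ ha hx') (e b y g₂ hb hy')
    _ = _ := (ENNReal.ofReal_add (by positivity) (by positivity)).symm

/-- Smoothing of order two at the final time. -/
theorem sobolevWeight_mul_mittagLeffler_le {γ T : ℝ} (hγ₀ : 0 < γ) (hγ₁ : γ < 1) (hT : 0 < T)
    (p : ℝ) (η : Space n) :
    sobolevWeight (p + 2) η * mittagLeffler γ (-‖(2 * Real.pi) • η‖ ^ 2 * T ^ γ) ≤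
      (1 + Real.Gamma (γ + 1) / T ^ γ) * sobolevWeight p η := by
  have hΓ₂ := Real.Gamma_pos_of_pos (show 0 < γ + 1 by linarith)
  set x := ‖(2 * Real.pi) • η‖ ^ 2 with hxdef
  have hx : 0 ≤ x := by positivity
  have hTγ : 0 < T ^ γ := Real.rpow_pos_of_pos hT γ
  have hw : sobolevWeight (p + 2) η = sobolevWeight p η * (1 + x) := by
    rw [sobolevWeight, add_div, div_self two_ne_zero, Real.rpow_add (by positivity), Real.rpow_one]
    rfl
  have h2 := (mittagLeffler_neg_bounds hγ₀ hγ₁ (x := x * T ^ γ) (by positivity)).2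
  have h3 : (1 + x) * (1 + x * T ^ γ / Real.Gamma (γ + 1))⁻¹ ≤
      1 + Real.Gamma (γ + 1) / T ^ γ := by
    rw [← div_eq_mul_inv, div_le_iff₀ (by positivity)]
    have e : (1 + Real.Gamma (γ + 1) / T ^ γ) * (1 + x * T ^ γ / Real.Gamma (γ + 1)) =
        1 + x + (Real.Gamma (γ + 1) / T ^ γ + x * T ^ γ / Real.Gamma (γ + 1)) := by
      field_simp; ring
    rw [e]
    have : 0 ≤ Real.Gamma (γ + 1) / T ^ γ + x * T ^ γ / Real.Gamma (γ + 1) := by positivity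
    linarith
  have hp := sobolevWeight_pos p η
  rw [hw, neg_mul, mul_assoc, mul_comm _ (sobolevWeight p η)]
  refine mul_le_mul_of_nonneg_left ?_ hp.le
  exact (mul_le_mul_of_nonneg_left h2 (by positivity)).trans h3

/-- For y ≤ 1, 1 - e^(-z) ≤ z and y^s ≤ y^q, which is where q ≤ s enters; for y ≥ 1 the left side is
below 1 ≤ y^q. -/
theorem one_sub_exp_le {τ s q y : ℝ} (hτ : 0 < τ) (hq : 0 ≤ q) (hqs : q ≤ s) (hy : 0 ≤ y) :
    1 - Real.exp (-τ * y ^ s) ≤ (1 + τ) * y ^ q := by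
  have hyq : 0 ≤ y ^ q := Real.rpow_nonneg hy q
  rcases le_total y 1 with h | h
  · rcases hy.eq_or_lt with rfl | hy
    · rcases hq.eq_or_lt with rfl | hq
      · rw [Real.rpow_zero]; linarith [Real.exp_pos (-τ * 0 ^ s)]
      · rw [Real.zero_rpow (hq.trans_le hqs).ne', Real.zero_rpow hq.ne']; simp
    · have h1 : y ^ s ≤ y ^ q := Real.rpow_le_rpow_of_exponent_ge hy h hqs
      have h2 := Real.add_one_le_exp (-τ * y ^ s)
      nlinarith
  · have h1 : 1 ≤ y ^ q := Real.one_le_rpow h hq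
    nlinarith [Real.exp_pos (-τ * y ^ s)]

theorem one_sub_freqSymbol_le {τ s q α : ℝ} (hτ : 0 < τ) (hq : 0 ≤ q) (hqs : q ≤ s) (hα : 0 < α)
    (η : Space n) : 1 - freqSymbol τ s α η ≤ (1 + τ) * α ^ q * sobolevWeight q η := by
  set r := ‖(2 * Real.pi) • η‖
  have hr : 0 ≤ r := norm_nonneg _
  have hαr : ‖(2 * Real.pi * α) • η‖ = α * r := by
    rw [mul_comm (2 * Real.pi) α, ← smul_smul, norm_smul, Real.norm_eq_abs, abs_of_pos hα]
  have h1 : r ^ q ≤ sobolevWeight q η := by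
    calc r ^ q = (r ^ 2) ^ (q / 2) := by
          rw [← Real.rpow_natCast r 2, ← Real.rpow_mul hr]; congr 1; push_cast; ring
      _ ≤ _ := Real.rpow_le_rpow (by positivity) (by linarith) (by positivity)
  rw [freqSymbol, hαr]
  refine (one_sub_exp_le hτ hq hqs (mul_nonneg hα.le hr)).trans ?_
  rw [Real.mul_rpow hα.le hr, ← mul_assoc]
  gcongr

/-- Pointwise interpolation: W_l = W^(l/q), and each summand dominates on one side of the threshold
W = κ. Keeping κ free lets the two error bounds be balanced afterwards. -/
theorem sobolevWeight_le_interp {l q κ : ℝ} (hl : 0 ≤ l) (hlq : l ≤ q) (hq : 0 < q) (hκ : 0 < κ)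
    (η : Space n) :
    sobolevWeight l η ≤ κ ^ (l / q) + κ ^ (l / q - 1) * sobolevWeight q η := by
  set W := sobolevWeight q η
  have hW : 0 < W := sobolevWeight_pos q η
  have hϑ₀ : 0 ≤ l / q := by positivity
  have hϑ₁ : l / q ≤ 1 := (div_le_one hq).2 hlq
  have e : sobolevWeight l η = W ^ (l / q) := by
    simp only [W, sobolevWeight]
    rw [← Real.rpow_mul (by positivity)]
    congr 1; field_simp
  have h1 : 0 < κ ^ (l / q) := Real.rpow_pos_of_pos hκ _
  have h2 : 0 < κ ^ (l / q - 1) := Real.rpow_pos_of_pos hκ _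
  rw [e]
  rcases le_total W κ with h | h
  · have := Real.rpow_le_rpow hW.le h hϑ₀
    have : 0 < κ ^ (l / q - 1) * W := by positivity
    linarith
  · have h3 : W ^ (l / q) = W ^ (l / q - 1) * W := by
      rw [Real.rpow_sub_one hW.ne', div_mul_cancel₀ _ hW.ne']
    have h4 : W ^ (l / q - 1) ≤ κ ^ (l / q - 1) :=
      Real.rpow_le_rpow_of_nonpos hκ h (by linarith)
    rw [h3]
    have := mul_le_mul_of_nonneg_right h4 hW.le
    linarith

theorem norm_two_pi_smul_sq (η : Space n) :
    ‖(2 * Real.pi) • η‖ ^ 2 = (2 * Real.pi) ^ 2 * ‖η‖ ^ 2 := by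
  rw [norm_smul, Real.norm_eq_abs, abs_of_pos Real.two_pi_pos, mul_pow (2 * Real.pi)]

/-- Regularity of the solution at the final time. -/
theorem IsSolution.eLpNorm_final_le {γ T p E : ℝ} (hγ₀ : 0 < γ) (hγ₁ : γ < 1) (hT : 0 < T)
    (hE : 0 ≤ E) {u : ℝ → L2 n} (hu : IsSolution γ T u)
    (h0 : sobolevNorm p (u 0) ≤ ENNReal.ofReal E) :
    eLpNorm (fun η => (sobolevWeight (p + 2) η : ℂ) * (𝓕 (u T) : L2 n) η) 2 volume ≤
      ENNReal.ofReal ((1 + Real.Gamma (γ + 1) / T ^ γ) * E) := by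
  have hΓ₂ := Real.Gamma_pos_of_pos (show 0 < γ + 1 by linarith)
  rw [sobolevNorm_eq] at h0
  have hm := aestronglyMeasurable_ofReal_mul (measurable_sobolevWeight p)
    (Lp.aestronglyMeasurable (𝓕 (u 0) : L2 n))
  have h := eLpNorm_le_of_norm_le_add (a := 1 + Real.Gamma (γ + 1) / T ^ γ) (b := 0)
    (f := fun η => (sobolevWeight (p + 2) η : ℂ) * (𝓕 (u T) : L2 n) η)
    (by positivity) le_rfl hE hE hm hm h0 h0 ?_
  · simpa using h
  filter_upwards [hu.fourier_ae_eq hγ₀ hγ₁ (right_mem_Ioc.2 hT)] with η h1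
  have h2 := sobolevWeight_mul_mittagLeffler_le hγ₀ hγ₁ hT p η
  have h3 := (norm_two_pi_smul_sq η).symm
  have hM := mittagLeffler_neg_pos hγ₀ hγ₁ (x := ‖(2 * Real.pi) • η‖ ^ 2 * T ^ γ) (by positivity)
  rw [← neg_mul] at hM
  rw [h1, h3, norm_mul, norm_mul, norm_mul, Complex.norm_real, Complex.norm_real, Complex.norm_real,
    Real.norm_eq_abs, Real.norm_eq_abs, Real.norm_eq_abs, abs_of_pos (sobolevWeight_pos _ η),
    abs_of_pos (sobolevWeight_pos _ η), abs_of_pos hM, zero_mul, add_zero, ← mul_assoc, ← mul_assoc]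
  exact mul_le_mul_of_nonneg_right h2 (norm_nonneg _)

theorem IsSolution.fourier_ae_eq_timeRatio {γ T t : ℝ} (hγ₀ : 0 < γ) (hγ₁ : γ < 1)
    (ht : t ∈ Ioc 0 T) {u : ℝ → L2 n} (hu : IsSolution γ T u) :
    (𝓕 (u t) : L2 n) =ᵐ[volume] fun η => (timeRatio γ T t η : ℂ) * (𝓕 (u T) : L2 n) η := by
  have hT : 0 < T := ht.1.trans_le ht.2
  filter_upwards [hu.fourier_ae_eq hγ₀ hγ₁ ht, hu.fourier_ae_eq hγ₀ hγ₁ (right_mem_Ioc.2 hT)]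
    with η h1 h2
  have h3 := (norm_two_pi_smul_sq η).symm
  have hM := mittagLeffler_neg_pos hγ₀ hγ₁ (x := ‖(2 * Real.pi) • η‖ ^ 2 * T ^ γ) (by positivity)
  rw [← neg_mul] at hM
  rw [h1, h2, h3, ← mul_assoc, ← Complex.ofReal_mul, timeRatio, div_mul_cancel₀ _ hM.ne']

/-- The final-time error `û(T) - Ŝ ĝ` on the Fourier side: bounds in `L²` and in the weighted space
of order `q`, for the parameter given by the discrepancy principle. -/
theorem exists_final_error_bound (n : ℕ) {τ s q θ : ℝ} (hτ : 0 < τ) (hq : 0 < q) (hqs : q ≤ s)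
    (hθ : 1 < θ) :
    ∃ C, 0 < C ∧ ∀ (δ B α : ℝ) (h g : L2 n), 0 < δ → 0 ≤ B → 0 < α →
      eLpNorm (fun η => (sobolevWeight q η : ℂ) * (𝓕 h : L2 n) η) 2 volume ≤ ENNReal.ofReal B →
      ‖h - g‖ ≤ δ → discrepancy τ s α g = ENNReal.ofReal (θ * δ) →
      eLpNorm (fun η => (𝓕 h : L2 n) η - (freqSymbol τ s α η : ℂ) * (𝓕 g : L2 n) η) 2 volume ≤
          ENNReal.ofReal ((1 + θ) * δ) ∧
      eLpNorm (fun η => (sobolevWeight q η : ℂ) *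
          ((𝓕 h : L2 n) η - (freqSymbol τ s α η : ℂ) * (𝓕 g : L2 n) η)) 2 volume ≤
          ENNReal.ofReal (C * B) := by
  have hs : 0 < s := hq.trans_le hqs
  have hθ' : 0 < θ - 1 := sub_pos.2 hθ
  obtain ⟨K, hK, hKw⟩ := sobolevWeight_mul_freqSymbol_le (n := n) hτ hs hq.le
  refine ⟨1 + K * ((2 + τ) / (θ - 1)), by positivity, fun δ B α h g hδ hB hα hhB hhg hdisc => ?_⟩
  have hSm := measurable_freqSymbol (n := n) τ s α
  have hS0 := freqSymbol_pos (n := n) τ s α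
  have hS1 := freqSymbol_le_one (n := n) hτ s α
  have hD0 := one_sub_freqSymbol_nonneg (n := n) hτ s α
  have hh := Lp.aestronglyMeasurable (𝓕 h : L2 n)
  have hg := Lp.aestronglyMeasurable (𝓕 g : L2 n)
  have hwh := aestronglyMeasurable_ofReal_mul (measurable_sobolevWeight q) hh
  have hDg := (memLp_one_sub_freqSymbol_mul hτ s α (𝓕 g : L2 n)).aestronglyMeasurable
  rw [discrepancy_eq hτ hs hα] at hdisc
  have hdiff : eLpNorm (fun η => (𝓕 h : L2 n) η - (𝓕 g : L2 n) η) 2 volume ≤ ENNReal.ofReal δ := by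
    have e : eLpNorm (fun η => (𝓕 h : L2 n) η - (𝓕 g : L2 n) η) 2 volume =
        ENNReal.ofReal ‖h - g‖ := by
      rw [← Lp.norm_fourier_eq (h - g), fourier_sub_L2, ofReal_norm, Lp.enorm_def]
      exact eLpNorm_congr_ae (Lp.coeFn_sub _ _).symm
    rw [e]
    exact ENNReal.ofReal_le_ofReal hhg
  have hdm : AEStronglyMeasurable (fun η => (𝓕 h : L2 n) η - (𝓕 g : L2 n) η) volume := hh.sub hg
  have hαq : 0 < α ^ q := Real.rpow_pos_of_pos hα q
  -- The discrepancy principle read backwards: θδ = ‖(1-S)ĝ‖ ≤ δ + ‖(1-S)ĥ‖ ≤ δ + cB, and θ > 1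
  -- leaves a positive multiple of δ.
  have lower : ∀ c, 0 ≤ c → (∀ η : Space n, 1 - freqSymbol τ s α η ≤ c * sobolevWeight q η) →
      (θ - 1) * δ ≤ c * B := by
    intro c hc hcw
    have := eLpNorm_le_of_norm_le_add
      (f := fun η => ((1 - freqSymbol τ s α η : ℝ) : ℂ) * (𝓕 g : L2 n) η) zero_le_one hc hδ.le hB
      hdm hwh hdiff hhB (Eventually.of_forall fun η => by
        rw [norm_mul, norm_mul, Complex.norm_real, Complex.norm_real, Real.norm_eq_abs,
          Real.norm_eq_abs, abs_of_nonneg (hD0 η), abs_of_pos (sobolevWeight_pos q η), ← mul_assoc]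
        have h1 : ‖(𝓕 g : L2 n) η‖ ≤ ‖(𝓕 h : L2 n) η - (𝓕 g : L2 n) η‖ + ‖(𝓕 h : L2 n) η‖ := by
          rw [norm_sub_rev]; exact norm_le_norm_sub_add _ _
        calc (1 - freqSymbol τ s α η) * ‖(𝓕 g : L2 n) η‖
            ≤ (1 - freqSymbol τ s α η) *
              (‖(𝓕 h : L2 n) η - (𝓕 g : L2 n) η‖ + ‖(𝓕 h : L2 n) η‖) :=
              mul_le_mul_of_nonneg_left h1 (hD0 η)
          _ = (1 - freqSymbol τ s α η) * ‖(𝓕 h : L2 n) η - (𝓕 g : L2 n) η‖ +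
              (1 - freqSymbol τ s α η) * ‖(𝓕 h : L2 n) η‖ := by ring
          _ ≤ _ := add_le_add (mul_le_mul_of_nonneg_right (by linarith [hS0 η]) (norm_nonneg _))
              (mul_le_mul_of_nonneg_right (hcw η) (norm_nonneg _)))
    rw [hdisc, ENNReal.ofReal_le_ofReal_iff (by positivity)] at this
    linarith
  -- The choice c = 1 bounds δ by B; the choice c = (1+τ)α^q bounds α^(-q)δ by B. Their sum is the
  -- factor (2+τ)/(θ-1) in the constant.
  have low1 := lower 1 zero_le_one fun η => by
    linarith [hS0 η, one_le_sobolevWeight hq.le η]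
  have low2 := lower ((1 + τ) * α ^ q) (by positivity) (one_sub_freqSymbol_le hτ hq.le hqs hα)
  constructor
  · have := eLpNorm_le_of_norm_le_add
      (f := fun η => (𝓕 h : L2 n) η - (freqSymbol τ s α η : ℂ) * (𝓕 g : L2 n) η)
      zero_le_one zero_le_one hδ.le (by positivity) hdm hDg hdiff hdisc.le
      (Eventually.of_forall fun η => by
        rw [one_mul, one_mul]
        refine le_trans (le_of_eq (congrArg _ ?_)) (norm_add_le _ _)
        push_cast; ring)
    convert this using 2
    ring
  · have := eLpNorm_le_of_norm_le_add
      (f := fun η => (sobolevWeight q η : ℂ) *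
          ((𝓕 h : L2 n) η - (freqSymbol τ s α η : ℂ) * (𝓕 g : L2 n) η))
      zero_le_one (b := K * (1 + (α ^ q)⁻¹)) (by positivity) hB hδ.le hwh hdm hhB hdiff
      (Eventually.of_forall fun η => by
        -- The smooth exact datum carries the weight in the first term; in the second the data error
        -- carries it, tamed by the mollifier symbol.
        have e : (sobolevWeight q η : ℂ) *
            ((𝓕 h : L2 n) η - (freqSymbol τ s α η : ℂ) * (𝓕 g : L2 n) η) =
            ((1 - freqSymbol τ s α η : ℝ) : ℂ) * ((sobolevWeight q η : ℂ) * (𝓕 h : L2 n) η) +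
            ((sobolevWeight q η * freqSymbol τ s α η : ℝ) : ℂ) *
              ((𝓕 h : L2 n) η - (𝓕 g : L2 n) η) := by
          push_cast; ring
        rw [e]
        refine (norm_add_le _ _).trans (add_le_add ?_ ?_)
        · rw [norm_mul, Complex.norm_real, Real.norm_eq_abs, abs_of_nonneg (hD0 η)]
          exact mul_le_mul_of_nonneg_right (by linarith [hS0 η]) (norm_nonneg _)
        · rw [norm_mul, Complex.norm_real, Real.norm_eq_abs,
            abs_of_pos (mul_pos (sobolevWeight_pos q η) (hS0 η))]
          exact mul_le_mul_of_nonneg_right (hKw α hα η) (norm_nonneg _))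
    refine this.trans (ENNReal.ofReal_le_ofReal ?_)
    have h1 : (α ^ q)⁻¹ * ((θ - 1) * δ) ≤ (1 + τ) * B := by
      rw [inv_mul_le_iff₀ hαq]; linarith
    have h2 : (1 + (α ^ q)⁻¹) * δ ≤ (2 + τ) / (θ - 1) * B := by
      rw [div_mul_eq_mul_div, le_div_iff₀ hθ']
      linarith
    have h3 := mul_le_mul_of_nonneg_left h2 hK.le
    linarith

/-- The error estimate for any parameter satisfying the discrepancy equation. -/
theorem exists_sobolevNorm_error_bound (n : ℕ) {γ T τ s p θ : ℝ} (hγ₀ : 0 < γ) (hγ₁ : γ < 1)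
    (hT : 0 < T) (hτ : 0 < τ) (hp : 0 < p) (hps : p + 2 ≤ s) (hθ : 1 < θ) :
    ∃ C, 0 < C ∧ ∀ (δ E α : ℝ) (u : ℝ → L2 n) (g : L2 n), 0 < δ → 0 < E → 0 < α →
      IsSolution γ T u → sobolevNorm p (u 0) ≤ ENNReal.ofReal E → ‖u T - g‖ ≤ δ →
      discrepancy τ s α g = ENNReal.ofReal (θ * δ) →
      ∀ t ∈ Ioc 0 T, ∀ l ∈ Icc 0 (p + 2),
        sobolevNorm l (u t - regularizedSolution γ T τ s α g t) ≤
          ENNReal.ofReal (C / t ^ γ * E ^ (l / (p + 2)) * δ ^ (1 - l / (p + 2))) := by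
  have hq : 0 < p + 2 := by linarith
  have hs : 0 < s := hq.trans_le hps
  have hΓ₁ := Real.Gamma_pos_of_pos (sub_pos.2 hγ₁)
  have hΓ₂ := Real.Gamma_pos_of_pos (show 0 < γ + 1 by linarith)
  have hTγ : 0 < T ^ γ := Real.rpow_pos_of_pos hT γ
  obtain ⟨C₁, hC₁, hbound⟩ := exists_final_error_bound n hτ hq hps hθ
  set K := (1 + Real.Gamma (1 - γ) * Real.Gamma (γ + 1)) * T ^ γ
  set C₃ := 1 + Real.Gamma (γ + 1) / T ^ γ
  have hK : 0 < K := by positivity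
  have hC₃ : 0 < C₃ := by positivity
  refine ⟨K * (1 + θ + C₁ * C₃), by positivity, fun δ E α u g hδ0 hE hpos hu h0 hδ hdisc => ?_⟩
  obtain ⟨b1, b2⟩ := hbound δ (C₃ * E) α (u T) g hδ0 (by positivity) hpos
    (hu.eLpNorm_final_le hγ₀ hγ₁ hT hE.le h0) hδ hdisc
  intro t ht l hl
  have htγ : 0 < t ^ γ := Real.rpow_pos_of_pos ht.1 γ
  -- Interpolation threshold κ = E/δ: it balances κ^ϑ δ = κ^(ϑ-1) E = E^ϑ δ^(1-ϑ).
  have hκ : 0 < E / δ := by positivity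
  set ϑ := l / (p + 2)
  have hk1 : 0 < (E / δ) ^ ϑ := Real.rpow_pos_of_pos hκ _
  have hk2 : 0 < (E / δ) ^ (ϑ - 1) := Real.rpow_pos_of_pos hκ _
  have hm1 : AEStronglyMeasurable (fun η => (𝓕 (u T) : L2 n) η -
      (freqSymbol τ s α η : ℂ) * (𝓕 g : L2 n) η) volume :=
    (Lp.aestronglyMeasurable _).sub (aestronglyMeasurable_ofReal_mul
      (measurable_freqSymbol τ s α) (Lp.aestronglyMeasurable _))
  have hm2 := aestronglyMeasurable_ofReal_mul (measurable_sobolevWeight (p + 2)) hm1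
  rw [sobolevNorm_eq]
  have h := eLpNorm_le_of_norm_le_add
    (f := fun η => (sobolevWeight l η : ℂ) *
      (𝓕 (u t - regularizedSolution γ T τ s α g t) : L2 n) η)
    (a := K / t ^ γ * (E / δ) ^ ϑ) (b := K / t ^ γ * (E / δ) ^ (ϑ - 1))
    (by positivity) (by positivity) (by positivity) (by positivity) hm1 hm2 b1 b2 ?_
  · refine h.trans (ENNReal.ofReal_le_ofReal (le_of_eq ?_))
    rw [Real.div_rpow hE.le hδ0.le, Real.div_rpow hE.le hδ0.le, Real.rpow_sub_one hE.ne',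
      Real.rpow_sub_one hδ0.ne', Real.rpow_sub hδ0, Real.rpow_one]
    have h1 : δ ^ ϑ ≠ 0 := (Real.rpow_pos_of_pos hδ0 _).ne'
    field_simp
  · rw [fourier_sub_L2]
    filter_upwards [Lp.coeFn_sub (𝓕 (u t)) (𝓕 (regularizedSolution γ T τ s α g t)),
      hu.fourier_ae_eq_timeRatio hγ₀ hγ₁ ht,
      fourier_regularizedSolution hγ₀ hγ₁ hτ hs hpos hT.le ht.1.le g] with η e1 e2 e3
    rw [e1, Pi.sub_apply, e2, e3]
    set D := (𝓕 (u T) : L2 n) η - (freqSymbol τ s α η : ℂ) * (𝓕 g : L2 n) η with hD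
    have e4 : (timeRatio γ T t η : ℂ) * (𝓕 (u T) : L2 n) η -
        ((timeRatio γ T t η * freqSymbol τ s α η : ℝ) : ℂ) * (𝓕 g : L2 n) η =
        (timeRatio γ T t η : ℂ) * D := by
      rw [hD]; push_cast; ring
    have r0 := timeRatio_nonneg hγ₀ hγ₁ hT.le ht.1.le η
    have r1 := timeRatio_le hγ₀ hγ₁ ht η
    have w0 := sobolevWeight_pos l η
    have w1 := sobolevWeight_pos (p + 2) η
    have w2 := sobolevWeight_le_interp hl.1 hl.2 hq hκ η
    rw [e4, norm_mul, norm_mul, norm_mul, Complex.norm_real, Complex.norm_real,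
      Complex.norm_real, Real.norm_eq_abs, Real.norm_eq_abs, Real.norm_eq_abs, abs_of_pos w0,
      abs_of_nonneg r0, abs_of_pos w1]
    calc sobolevWeight l η * (timeRatio γ T t η * ‖D‖)
        ≤ ((E / δ) ^ ϑ + (E / δ) ^ (ϑ - 1) * sobolevWeight (p + 2) η) * (K / t ^ γ * ‖D‖) := by
          gcongr
      _ = _ := by ring

end FractionalDiffusion

end

open FractionalDiffusion in
theorem mainTheorem6
    (n : ℕ) (hn : 1 ≤ n)
    (γ T : ℝ) (hγ₀ : 0 < γ) (hγ₁ : γ < 1) (hT : 0 < T)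
    (τ s : ℝ) (hτ : 0 < τ) (hs : 0 < s)
    (p : ℝ) (hp : 0 < p) (hps : p + 2 ≤ s)
    (θ : ℝ) (hθ : 1 < θ) :
    ∃ C : ℝ, 0 < C ∧
      ∀ (δ E : ℝ) (u : ℝ → L2 n) (gδ : L2 n),
        0 < E →
        IsSolution γ T u →
        sobolevNorm p (u 0) ≤ ENNReal.ofReal E →
        ‖u T - gδ‖ ≤ δ →
        0 < θ * δ →
        θ * δ < ‖gδ‖ →
        -- the a-posteriori parameter and the regularised solution are well defined
        (IsLUB (morozovSet τ s θ δ gδ) (morozovParameter τ s θ δ gδ) ∧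
          0 < morozovParameter τ s θ δ gδ ∧
          ∀ α : ℝ, 0 < α →
            (discrepancy τ s α gδ = ENNReal.ofReal (θ * δ) ↔
              α = morozovParameter τ s θ δ gδ)) ∧
        (∀ t ∈ Set.Icc 0 T,
          fourierL2 (regularizedSolution γ T τ s (morozovParameter τ s θ δ gδ) gδ t)
            =ᵐ[MeasureTheory.volume]
          regularizedHat γ T τ s (morozovParameter τ s θ δ gδ) gδ t) ∧
        -- the error estimate in `H^l`
        (∀ t ∈ Set.Ioc 0 T, ∀ l ∈ Set.Icc 0 (p + 2), p + 2 - l ≤ s →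
          sobolevNorm l
              (u t - regularizedSolution γ T τ s (morozovParameter τ s θ δ gδ) gδ t)
            ≤ ENNReal.ofReal
                (C / t ^ γ * E ^ (l / (p + 2)) * δ ^ (1 - l / (p + 2)))) ∧
        -- the error estimate in `L²`
        (∀ t ∈ Set.Ioc 0 T,
          ‖u t - regularizedSolution γ T τ s (morozovParameter τ s θ δ gδ) gδ t‖
            ≤ C / t ^ γ * δ) := by
  obtain ⟨C, hC, hbound⟩ := exists_sobolevNorm_error_bound n hγ₀ hγ₁ hT hτ hp hps hθ
  refine ⟨C, hC, fun δ E u g hE hu h0 hδ hθδ hg => ?_⟩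
  have hδ0 : 0 < δ := pos_of_mul_pos_right hθδ (by linarith)
  obtain ⟨hlub, hpos, hdisc⟩ := morozovSet_eq hn hτ hs hθδ hg
  have main := hbound δ E _ u g hδ0 hE hpos hu h0 hδ ((hdisc _ hpos).2 rfl)
  refine ⟨⟨hlub, hpos, hdisc⟩, fun t ht =>
    fourierL2_regularizedSolution hγ₀ hγ₁ hτ hs hpos hT.le ht.1 g, fun t ht l hl _ => main t ht l hl,
    fun t ht => ?_⟩
  have htγ : 0 < t ^ γ := Real.rpow_pos_of_pos ht.1 γ
  have h := main t ht 0 ⟨le_rfl, by linarith⟩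
  rw [sobolevNorm_zero, zero_div, Real.rpow_zero, sub_zero, Real.rpow_one, mul_one,
    ENNReal.ofReal_le_ofReal_iff (by positivity)] at h
  exact h
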